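/- **Setting.** All manifolds are smooth, Hausdorff, second countable and finite dimensional. Let $\tau\colon M\to X$ be a smooth surjective submersion onto an $n$-dimensional manifold $X$. A *regular graded Dirac structure of order $n$* on $M$ consists of vector subbundles $S^a\subseteq\bigwedge^aT^*M$ ($1\le a\le n$) with $S^a=\iota_{TM}S^{a+1}$ for $a<n$, and vector bundle maps $\sharp_a\colon S^a\to\bigwedge^{n+1-a}TM/K_{n+1-a}$, where $K_p=\{U\in\bigwedge^pTM:\iota_US^p=0\}$, such that, with $p=n+1-a$ and $q=n+1-b$: 1. $\iota_{\sharp_a(\alpha)}\beta=(-1)^{pq}\,\iota_{\sharp_b(\beta)}\alpha$ for all $\alpha\in S^a$, $\beta\in S^b$; 2. if $a+b\ge n+1$, $\alpha,\beta$ are sections of $S^a,S^b$ and $U,V$ are multivector fields with $\sharp_a(\alpha)=U+K_p$, $\sharp_b(\beta)=V+K_q$, then $$\theta=(-1)^{(p-1)q}\pounds_U\beta+(-1)^q\pounds_V\alpha-\tfrac{(-1)^q}{2}\,d\bigl(\iota_V\alpha+(-1)^{pq}\iota_U\beta\bigr)$$ is a section of $S^{a+b-n}$ and $\sharp_{a+b-n}(\theta)=[U,V]+K_{p+q-1}$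 (Schouten–Nijenhuis bracket; $\pounds_U=d\,\iota_U-(-1)^p\iota_U\,d$). It is *fibered over $X$* if every $S^a$ contains all semi-basic $a$-forms (those annihilated by every $\tau$-vertical vector) and consists of forms annihilated by any two $\tau$-vertical vectors. A *Hamiltonian $a$-form* ($0\le a\le n-1$), $\alpha\in\Omega^a_H(M)$, is a smooth $a$-form with $d\alpha$ a section of $S^{a+1}$. For $\alpha\in\Omega_H^a(M)$ and $\beta\in\Omega_H^b(M)$ with $a+b\ge n-1$ the graded Poisson bracket is the $(a+b-(n-1))$-form $\{\alpha,\beta\}=(-1)^{n-1-b}\,\iota_{\sharp_{b+1}(d\beta)}d\alpha$. A form is *basic* if it is the pullback by $\tau$ of a smooth form on $X$. A Hamiltonian $a$-form $\alpha$ is *special Hamiltonian*, $\alpha\in\widetilde\Omega^a_H(M)$, if $\alpha\wedge\varepsilon\in\Omega^{n-1}_H(M)$ for every closed basic $(n-1-a)$-form $\varepsilon$. **Theorem.** Let $(\tau\colon M\to X,S^a,\sharp_a)$ be a fibered graded Dirac manifold of order $n=\dim X$; if $n\ge2$, assume that $\sharp_n\colon S^n\to TM/K_1$ takes vertical values, i.e.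 values in $\ker d\tau/K_1$. Suppose that for every special Hamiltonian form $\alpha\in\widetilde\Omega^a_H(M)$ there is a multivector field $U_\alpha\in\mathfrak X^{n-a}(M)$ such that $\sharp_{a+1}(d\alpha)=U_\alpha+K_{n-a}$ and such that, for every closed basic $b$-form $\varepsilon$ with $0\le b\le n-1-a$, there is a nonzero real constant $C(\alpha,\varepsilon)$ with $$\sharp_{a+b+1}(d\alpha\wedge\varepsilon)=C(\alpha,\varepsilon)\,\iota_\varepsilon U_\alpha+K_{n-(a+b)}.$$ Then the special Hamiltonian forms define a subalgebra: every $\widetilde\Omega^a_H(M)$ is a linear subspace of $\Omega^a(M)$, and for $\alpha\in\widetilde\Omega^a_H(M)$, $\beta\in\widetilde\Omega^b_H(M)$ with $a+b\ge n-1$ one has $\{\alpha,\beta\}\in\widetilde\Omega^{\,a+b-(n-1)}_H(M)$. -/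

import Mathlib

open scoped Manifold ContDiff Topology

noncomputable section

namespace GDirac

/-! ### Multilinear algebra on a finite-dimensional space -/

section Algebra

variable {E : Type*} [NormedAddCommGroup E] [NormedSpace ℝ E]

/-- Alternating `a`-forms on `E`, i.e. the elements of `⋀^a E*`. -/
abbrev Alt (E : Type*) [NormedAddCommGroup E] [NormedSpace ℝ E] (a : ℕ) : Type _ :=
  E [⋀^Fin a]→L[ℝ] ℝ

/-- The `p`-vectors on a finite-dimensional space `E`, where `⋀^p E` is realised as the dual of
the space `⋀^p E*` of `p`-forms (the canonical identification in finite dimension): a decomposable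
`p`-vector `u₁ ∧ ⋯ ∧ uₚ` is the functional `σ ↦ σ(u₁, …, uₚ)`. -/
abbrev MVec (E : Type*) [NormedAddCommGroup E] [NormedSpace ℝ E] (p : ℕ) : Type _ :=
  Module.Dual ℝ (Alt E p)

theorem continuous_of_alternating [FiniteDimensional ℝ E] {a : ℕ} (f : E [⋀^Fin a]→ₗ[ℝ] ℝ) :
    Continuous f := by
  classical
  set b := Module.finBasis ℝ E
  have key : ∀ v : Fin a → E, f v = ∑ r : (Fin a → Fin (Module.finrank ℝ E)),
      (∏ i, b.repr (v i) (r i)) * f (fun i => b (r i)) := by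
    intro v
    have h : v = fun i => ∑ j, b.repr (v i) j • b j := by
      funext i; exact (b.sum_repr (v i)).symm
    conv_lhs => rw [h]
    change f.toMultilinearMap _ = _
    rw [MultilinearMap.map_sum]
    refine Finset.sum_congr rfl fun r _ => ?_
    rw [MultilinearMap.map_smul_univ]
    rfl
  have : (f : (Fin a → E) → ℝ) = fun v => ∑ r : (Fin a → Fin (Module.finrank ℝ E)),
      (∏ i, b.repr (v i) (r i)) * f (fun i => b (r i)) := funext key
  rw [this]
  refine continuous_finsetSum _ fun r _ => Continuous.mul ?_ continuous_const
  refine continuous_finsetProd _ fun i _ => ?_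
  exact (LinearMap.continuous_of_finiteDimensional (b.coord (r i))).comp (continuous_apply i)

/-- In finite dimension every alternating map is continuous. -/
def ofAlternating [FiniteDimensional ℝ E] {a : ℕ} (f : E [⋀^Fin a]→ₗ[ℝ] ℝ) : Alt E a where
  toMultilinearMap := f.toMultilinearMap
  cont := continuous_of_alternating f
  map_eq_zero_of_eq' := f.map_eq_zero_of_eq'

@[simp] theorem ofAlternating_apply [FiniteDimensional ℝ E] {a : ℕ} (f : E [⋀^Fin a]→ₗ[ℝ] ℝ)
    (v : Fin a → E) : ofAlternating f v = f v := rfl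

/-- The exterior product `α ∧ β`, `(α ∧ β)(v) = ∑ sign(σ) α(v_{σ(1)}, …) β(…, v_{σ(a+b)})`, the
sum being over the `(a, b)`-shuffles. -/
def wedge [FiniteDimensional ℝ E] {a b : ℕ} (α : Alt E a) (β : Alt E b) : Alt E (a + b) :=
  ofAlternating
    (((LinearMap.mul' ℝ ℝ).compAlternatingMap
      (α.toAlternatingMap.domCoprod β.toAlternatingMap)).domDomCongr finSumFinEquiv)

theorem wedge_add [FiniteDimensional ℝ E] {a b : ℕ} (α : Alt E a) (β β' : Alt E b) :
    wedge α (β + β') = wedge α β + wedge α β' := by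
  have h : α.toAlternatingMap.domCoprod (β + β').toAlternatingMap
      = α.toAlternatingMap.domCoprod β.toAlternatingMap
        + α.toAlternatingMap.domCoprod β'.toAlternatingMap := by
    simp only [← AlternatingMap.domCoprod'_apply, ContinuousAlternatingMap.toAlternatingMap_add,
      TensorProduct.tmul_add, map_add]
  ext v
  simp only [wedge, h, ofAlternating_apply, LinearMap.compAlternatingMap_apply,
    AlternatingMap.domDomCongr_apply, AlternatingMap.add_apply, map_add,
    ContinuousAlternatingMap.add_apply]

theorem wedge_smul [FiniteDimensional ℝ E] {a b : ℕ} (α : Alt E a) (r : ℝ) (β : Alt E b) :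
    wedge α (r • β) = r • wedge α β := by
  have h : α.toAlternatingMap.domCoprod (r • β).toAlternatingMap
      = r • α.toAlternatingMap.domCoprod β.toAlternatingMap := by
    simp only [← AlternatingMap.domCoprod'_apply, ContinuousAlternatingMap.toAlternatingMap_smul,
      TensorProduct.tmul_smul, map_smul]
  ext v
  simp only [wedge, h, ofAlternating_apply, LinearMap.compAlternatingMap_apply,
    AlternatingMap.domDomCongr_apply, AlternatingMap.smul_apply, map_smul,
    ContinuousAlternatingMap.smul_apply]

/-- Transport of a form along an equality of degrees. -/
def castDeg {a b : ℕ} (h : a = b) (α : Alt E a) : Alt E b := h ▸ α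

theorem castDeg_add {a b : ℕ} (h : a = b) (α β : Alt E a) :
    castDeg h (α + β) = castDeg h α + castDeg h β := by
  subst h; rfl

theorem castDeg_smul {a b : ℕ} (h : a = b) (r : ℝ) (α : Alt E a) :
    castDeg h (r • α) = r • castDeg h α := by
  subst h; rfl

theorem append_update_left {V : Type*} {p c : ℕ} [DecidableEq (Fin p)] (v : Fin p → V)
    (w : Fin c → V) (i : Fin p) (z : V) : Fin.append (Function.update v i z) w
      = Function.update (Fin.append v w) (Fin.castAdd c i) z := by
  funext j
  refine Fin.addCases (fun k => ?_) (fun k => ?_) j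
  · by_cases hk : k = i
    · subst hk; simp
    · have : Fin.castAdd c k ≠ Fin.castAdd c i := fun e => hk (Fin.castAdd_injective _ _ e)
      simp [hk, this]
  · have : Fin.natAdd p k ≠ Fin.castAdd c i := by
      intro e
      have := congrArg Fin.val e
      simp only [Fin.val_natAdd, Fin.val_castAdd] at this
      omega
    simp [this]

theorem append_update_right {V : Type*} {p c : ℕ} [DecidableEq (Fin c)] (v : Fin p → V)
    (w : Fin c → V) (i : Fin c) (z : V) : Fin.append v (Function.update w i z)
      = Function.update (Fin.append v w) (Fin.natAdd p i) z := by
  funext j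
  refine Fin.addCases (fun k => ?_) (fun k => ?_) j
  · have : Fin.castAdd c k ≠ Fin.natAdd p i := by
      intro e
      have := congrArg Fin.val e
      simp only [Fin.val_natAdd, Fin.val_castAdd] at this
      omega
    simp [this]
  · by_cases hk : k = i
    · subst hk; simp
    · have : Fin.natAdd p k ≠ Fin.natAdd p i := fun e => hk (Fin.natAdd_injective _ _ e)
      simp [hk, this]

theorem continuous_append_left {V : Type*} [TopologicalSpace V] {p c : ℕ} (w : Fin c → V) :
    Continuous (fun v : Fin p → V => Fin.append v w) := by
  refine continuous_pi fun j => ?_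
  refine Fin.addCases (fun k => ?_) (fun k => ?_) j
  · simpa using continuous_apply k
  · simpa using continuous_const

/-- For `α ∈ ⋀^{p+c} E*` and `w ∈ E^c`, the `p`-form `v ↦ α(v₁, …, vₚ, w₁, …, w_c)`. -/
def slice {p c : ℕ} (α : Alt E (p + c)) (w : Fin c → E) : Alt E p where
  toFun v := α (Fin.append v w)
  map_update_add' v i x y := by
    simp only [append_update_left]; exact α.map_update_add _ _ _ _
  map_update_smul' v i r x := by
    simp only [append_update_left]; exact α.map_update_smul _ _ _ _
  map_eq_zero_of_eq' v i j hij hne := by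
    refine α.map_eq_zero_of_eq _ (i := Fin.castAdd c i) (j := Fin.castAdd c j) (by simp [hij]) ?_
    exact fun e => hne (Fin.castAdd_injective _ _ e)
  cont := α.cont.comp (continuous_append_left w)

@[simp] theorem slice_apply {p c : ℕ} (α : Alt E (p + c)) (w : Fin c → E) (v : Fin p → E) :
    slice α w v = α (Fin.append v w) := rfl

/-- The contraction `ι_U α ∈ ⋀^c E*` of `α ∈ ⋀^{p+c} E*` with a `p`-vector `U`:
`(ι_U α)(w) = U(α(·, …, ·, w₁, …, w_c))`. In particular
`ι_{u₁ ∧ ⋯ ∧ uₚ} α = α(u₁, …, uₚ, ·, …, ·) = ι_{uₚ} ⋯ ι_{u₁} α`. -/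
def interior [FiniteDimensional ℝ E] {p c a : ℕ} (h : p + c = a) (U : MVec E p) (α : Alt E a) :
    Alt E c :=
  ofAlternating
    { toFun := fun w => U (slice (castDeg h.symm α) w)
      map_update_add' := fun w i x y => by
        rw [← map_add]
        congr 1
        ext v
        simp only [slice_apply, ContinuousAlternatingMap.add_apply, append_update_right]
        exact ContinuousAlternatingMap.map_update_add _ _ _ _ _
      map_update_smul' := fun w i r x => by
        rw [← map_smul]
        congr 1
        ext v
        simp only [slice_apply, ContinuousAlternatingMap.smul_apply, append_update_right]
        exact ContinuousAlternatingMap.map_update_smul _ _ _ _ _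
      map_eq_zero_of_eq' := fun w i j hij hne => by
        rw [← map_zero U]
        congr 1
        ext v
        rw [slice_apply]
        refine ContinuousAlternatingMap.map_eq_zero_of_eq _ _ (i := Fin.natAdd p i)
          (j := Fin.natAdd p j) (by simp [hij]) ?_
        exact fun e => hne (Fin.natAdd_injective _ _ e) }

@[simp] theorem interior_apply [FiniteDimensional ℝ E] {p c a : ℕ} (h : p + c = a)
    (U : MVec E p) (α : Alt E a) (w : Fin c → E) :
    interior h U α w = U (slice (castDeg h.symm α) w) := rfl

/-- The contraction `ι_ε U ∈ ⋀^p E` of a `k`-vector `U`, `k = b + p`, with a `b`-form `ε`: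
`⟨η, ι_ε U⟩ = ⟨ε ∧ η, U⟩` for every `p`-form `η`. -/
def contractForm [FiniteDimensional ℝ E] {b p k : ℕ} (h : b + p = k) (ε : Alt E b)
    (U : MVec E k) : MVec E p where
  toFun η := U (castDeg h (wedge ε η))
  map_add' η η' := by rw [wedge_add, castDeg_add, map_add]
  map_smul' r η := by rw [wedge_smul, castDeg_smul, map_smul]; rfl

/-- A form is semi-basic for a linear map `T` (the differential of a projection) if its
contraction with every vertical vector, i.e. every `v` with `T v = 0`, vanishes. -/
def IsSemibasic {F : Type*} [NormedAddCommGroup F] [NormedSpace ℝ F] {a : ℕ}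
    (T : E →L[ℝ] F) (α : Alt E a) : Prop :=
  ∀ v : Fin a → E, (∃ i, T (v i) = 0) → α v = 0

/-- An `a`-form is `r`-horizontal if it vanishes whenever at least `a + 1 - r` of its arguments
are vertical. -/
def IsHorizontal {F : Type*} [NormedAddCommGroup F] [NormedSpace ℝ F] {a : ℕ}
    (T : E →L[ℝ] F) (r : ℕ) (α : Alt E a) : Prop :=
  ∀ v : Fin a → E, (∃ s : Finset (Fin a), a + 1 ≤ r + s.card ∧ ∀ i ∈ s, T (v i) = 0) → α v = 0

end Algebra

/-! ### Differential forms and multivector fields on a manifold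

`M` is a manifold modelled on the finite-dimensional space `E`. In Mathlib the tangent space
`TangentSpace 𝓘(ℝ, E) x` is, by definition, the model space `E` (identified through the preferred
chart at `x`), so an alternating form on the tangent space at `x` is an element of `Alt E a`. -/

section Manifold

variable {E : Type*} [NormedAddCommGroup E] [NormedSpace ℝ E] [FiniteDimensional ℝ E]
  {M : Type*} [TopologicalSpace M] [ChartedSpace E M]

/-- Fields of `a`-forms on `M` (not necessarily smooth). -/
abbrev Form (E : Type*) [NormedAddCommGroup E] [NormedSpace ℝ E] (M : Type*) (a : ℕ) : Type _ :=
  M → Alt E a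

/-- Fields of `p`-vectors on `M` (not necessarily smooth). -/
abbrev MVField (E : Type*) [NormedAddCommGroup E] [NormedSpace ℝ E] (M : Type*) (p : ℕ) :
    Type _ :=
  M → MVec E p

/-- The differential at `x` of the preferred chart at `x₀`. -/
def chartDeriv (E : Type*) [NormedAddCommGroup E] [NormedSpace ℝ E] {M : Type*}
    [TopologicalSpace M] [ChartedSpace E M] (x₀ x : M) : E →L[ℝ] E :=
  mfderiv 𝓘(ℝ, E) 𝓘(ℝ, E) (extChartAt 𝓘(ℝ, E) x₀) x

/-- The differential at `y` of the inverse of the preferred chart at `x₀`. -/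
def chartSymmDeriv (E : Type*) [NormedAddCommGroup E] [NormedSpace ℝ E] {M : Type*}
    [TopologicalSpace M] [ChartedSpace E M] (x₀ : M) (y : E) : E →L[ℝ] E :=
  mfderiv 𝓘(ℝ, E) 𝓘(ℝ, E) (extChartAt 𝓘(ℝ, E) x₀).symm y

/-- The expression of a form in the preferred chart at `x₀`, a form on the target of the chart. -/
def formInChart {a : ℕ} (x₀ : M) (α : Form E M a) (y : E) : Alt E a :=
  (α ((extChartAt 𝓘(ℝ, E) x₀).symm y)).compContinuousLinearMap (chartSymmDeriv E x₀ y)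

/-- `α` is a smooth form on the open set `O`. -/
def SmoothFormOn {a : ℕ} (O : Set M) (α : Form E M a) : Prop :=
  ∀ x₀ : M, ContDiffOn ℝ ∞ (formInChart x₀ α)
    ((extChartAt 𝓘(ℝ, E) x₀).target ∩ (extChartAt 𝓘(ℝ, E) x₀).symm ⁻¹' O)

/-- `α ∈ Ω^a(M)`. -/
def SmoothForm {a : ℕ} (α : Form E M a) : Prop := SmoothFormOn Set.univ α

/-- `U` is a smooth `p`-vector field on the open set `O`: in every chart its components, i.e. the
pairings with the constant-coefficient forms of the chart, are smooth. -/
def SmoothMVOn {p : ℕ} (O : Set M) (U : MVField E M p) : Prop :=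
  ∀ (x₀ : M) (η : Alt E p), ContDiffOn ℝ ∞
    (fun y => U ((extChartAt 𝓘(ℝ, E) x₀).symm y)
      (η.compContinuousLinearMap (chartDeriv E x₀ ((extChartAt 𝓘(ℝ, E) x₀).symm y))))
    ((extChartAt 𝓘(ℝ, E) x₀).target ∩ (extChartAt 𝓘(ℝ, E) x₀).symm ⁻¹' O)

/-- `U ∈ 𝔛^p(M)`. -/
def SmoothMV {p : ℕ} (U : MVField E M p) : Prop := SmoothMVOn Set.univ U

/-- The exterior derivative, computed at `x` in the preferred chart at `x`. -/
def d {a : ℕ} (α : Form E M a) : Form E M (a + 1) := fun x =>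
  (extDeriv (formInChart x α) (extChartAt 𝓘(ℝ, E) x x)).compContinuousLinearMap
    (chartDeriv E x x)

/-- The exterior product of two fields of forms. -/
def wedgeF {a b : ℕ} (α : Form E M a) (β : Form E M b) : Form E M (a + b) :=
  fun x => wedge (α x) (β x)

/-- The contraction of a field of forms with a field of multivectors. -/
def interiorF {p c a : ℕ} (h : p + c = a) (U : MVField E M p) (α : Form E M a) : Form E M c :=
  fun x => interior h (U x) (α x)

/-- The Lie derivative `£_U β = d ι_U β - (-1)^p ι_U dβ` along a `p`-vector field, for a form `β`
of degree at least `p`. -/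
def lieDeriv {p c b : ℕ} (h : p + c = b) (U : MVField E M p) (β : Form E M b) :
    Form E M (c + 1) :=
  d (interiorF h U β) - (-1 : ℝ) ^ p • interiorF (by omega : p + (c + 1) = b + 1) U (d β)

/-- `W` is the Schouten-Nijenhuis bracket `[U, V]` of a `P`-vector field `U` and a `Q`-vector
field `V`, `P = p + 1`, `Q = q + 1`: for every form `η` of degree `P + Q - 1`,
`ι_{[U, V]} η = (-1)^{(P - 1) Q} £_U ι_V η - ι_V £_U η`, where `ι_V η` has degree `P - 1` so that
`£_U ι_V η = -(-1)^P ι_U d ι_V η`. -/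
def IsSchouten {p q : ℕ} (U : MVField E M (p + 1)) (V : MVField E M (q + 1))
    (W : MVField E M (p + q + 1)) : Prop :=
  ∀ η : Form E M (p + q + 1), SmoothForm η → ∀ x : M,
    W x (η x) =
      (-1 : ℝ) ^ (p * (q + 1)) * (-(-1 : ℝ) ^ (p + 1) *
        U x (d (interiorF (by omega : (q + 1) + p = p + q + 1) V η) x))
      - V x (lieDeriv (by omega : (p + 1) + q = p + q + 1) U η x)

/-- A family of subspaces of the fibres of `⋀^a T*M` is a (smooth) vector subbundle: it has smooth
local frames. -/
def IsSubbundle {a : ℕ} (S : M → Submodule ℝ (Alt E a)) : Prop :=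
  ∀ x₀ : M, ∃ O : Set M, IsOpen O ∧ x₀ ∈ O ∧ ∃ (k : ℕ) (e : Fin k → Form E M a),
    (∀ i, SmoothFormOn O (e i)) ∧
    ∀ x ∈ O, LinearIndependent ℝ (fun i => e i x) ∧
      Submodule.span ℝ (Set.range fun i => e i x) = S x

end Manifold

/-! ### Graded Dirac structures -/

section Dirac

variable {E : Type*} [NormedAddCommGroup E] [NormedSpace ℝ E] [FiniteDimensional ℝ E]
  {M : Type*} [TopologicalSpace M] [ChartedSpace E M]

/-- The form `(-1)^{(P-1)Q} £_U β + (-1)^Q £_V α - ((-1)^Q / 2) d(ι_V α + (-1)^{PQ} ι_U β)` of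
the integrability condition, where `U` is a `P`-vector field, `V` a `Q`-vector field, `P = p + 1`,
`Q = q + 1`. -/
def integrabilityForm {a b c p q : ℕ} (hU : (p + 1) + c = b) (hV : (q + 1) + c = a)
    (α : Form E M a) (β : Form E M b) (U : MVField E M (p + 1)) (V : MVField E M (q + 1)) :
    Form E M (c + 1) :=
  (-1 : ℝ) ^ (p * (q + 1)) • lieDeriv hU U β + (-1 : ℝ) ^ (q + 1) • lieDeriv hV V α
    - ((-1 : ℝ) ^ (q + 1) / 2) •
      d (interiorF hV V α + (-1 : ℝ) ^ ((p + 1) * (q + 1)) • interiorF hU U β)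

/-- A regular graded Dirac structure of order `n` on `M`: vector subbundles `S^a ⊆ ⋀^a T*M` and
vector bundle maps `♯_a : S^a → ⋀^p TM / K_p`, where `1 ≤ a ≤ n`, `p = n + 1 - a` and `K_p` is the
annihilator of `S^p`. Only the members `S a` with `1 ≤ a ≤ n` and `sharp a p` with `1 ≤ a ≤ n`,
`a + p = n + 1` belong to the structure; the others are never used. -/
structure GradedDirac (E : Type*) [NormedAddCommGroup E] [NormedSpace ℝ E]
    [FiniteDimensional ℝ E] (M : Type*) [TopologicalSpace M] [ChartedSpace E M] (n : ℕ) where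
  /-- The fibre of `S^a` at `x`. -/
  S : (a : ℕ) → (x : M) → Submodule ℝ (Alt E a)
  /-- The map `♯_a` at `x`, with values in the `p`-vectors modulo the annihilator `K_p`. -/
  sharp : (a p : ℕ) → (x : M) → S a x →ₗ[ℝ] MVec E p ⧸ (S p x).dualAnnihilator
  isSubbundle : ∀ a, 1 ≤ a → a ≤ n → IsSubbundle (S a)
  /-- `S^a = ι_{TM} S^{a+1}`. -/
  contraction : ∀ a, 1 ≤ a → a + 1 ≤ n → ∀ x,
    S a x = Submodule.span ℝ {σ | ∃ α ∈ S (a + 1) x, ∃ u : E, σ = α.curryLeft u}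
  /-- `♯_a` is smooth: it maps smooth local sections to sections of the quotient which have
  smooth local representatives. -/
  sharp_smooth : ∀ a p, 1 ≤ a → a ≤ n → a + p = n + 1 → ∀ O : Set M, IsOpen O →
    ∀ α : Form E M a, SmoothFormOn O α → ∀ hα : ∀ x ∈ O, α x ∈ S a x, ∀ x₀ ∈ O,
      ∃ (O' : Set M) (hO' : O' ⊆ O), IsOpen O' ∧ x₀ ∈ O' ∧ ∃ U : MVField E M p, SmoothMVOn O' U ∧
        ∀ x (hx : x ∈ O'), sharp a p x ⟨α x, hα x (hO' hx)⟩ = Submodule.Quotient.mk (U x)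
  /-- `ι_{♯_a(α)} β = (-1)^{pq} ι_{♯_b(β)} α`, with `p = n + 1 - a`, `q = n + 1 - b` and `c` the
  degree of both sides. -/
  skew : ∀ a b c p q, 1 ≤ a → a ≤ n → 1 ≤ b → b ≤ n → a + p = n + 1 → b + q = n + 1 →
    ∀ (hp : p + c = b) (hq : q + c = a) (x : M) (α : S a x) (β : S b x) (U : MVec E p)
      (V : MVec E q), sharp a p x α = Submodule.Quotient.mk U →
      sharp b q x β = Submodule.Quotient.mk V →
      interior hp U (β : Alt E b) = (-1 : ℝ) ^ (p * q) • interior hq V (α : Alt E a)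
  /-- The integrability condition. It is stated for the degrees in which `a + b - n = c + 1` is one
  of `1, …, n`; here `U` and `V` have orders `n + 1 - a = p + 1` and `n + 1 - b = q + 1`. -/
  integrable : ∀ a b c p q, 1 ≤ a → 1 ≤ b → a + p = n → b + q = n →
    ∀ (hU : (p + 1) + c = b) (hV : (q + 1) + c = a)
      (α : Form E M a) (β : Form E M b) (hα : ∀ x, α x ∈ S a x) (hβ : ∀ x, β x ∈ S b x)
      (U : MVField E M (p + 1)) (V : MVField E M (q + 1)),
      SmoothForm α → SmoothForm β → SmoothMV U → SmoothMV V →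
      (∀ x, sharp a (p + 1) x ⟨α x, hα x⟩ = Submodule.Quotient.mk (U x)) →
      (∀ x, sharp b (q + 1) x ⟨β x, hβ x⟩ = Submodule.Quotient.mk (V x)) →
      ∃ hθ : ∀ x, integrabilityForm hU hV α β U V x ∈ S (c + 1) x,
        ∀ W : MVField E M (p + q + 1), SmoothMV W → IsSchouten U V W → ∀ x,
          sharp (c + 1) (p + q + 1) x ⟨integrabilityForm hU hV α β U V x, hθ x⟩
            = Submodule.Quotient.mk (W x)

namespace GradedDirac

variable {n : ℕ} (D : GradedDirac E M n)

/-- `α ∈ Ω^a_H(M)`, `0 ≤ a ≤ n - 1`: a smooth `a`-form with `dα` a section of `S^{a+1}`. -/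
def IsHamiltonian (a : ℕ) (α : Form E M a) : Prop :=
  a + 1 ≤ n ∧ SmoothForm α ∧ ∀ x, d α x ∈ D.S (a + 1) x

/-- A multivector representing the class `♯_a(α)`. -/
def sharpRep {a : ℕ} (p : ℕ) (x : M) (α : D.S a x) : MVec E p :=
  (Submodule.Quotient.mk_surjective _ (D.sharp a p x α)).choose

/-- The graded Poisson bracket `{α, β} = (-1)^{deg_H β} ι_{♯_{b+1}(dβ)} dα`, where
`deg_H β = n - 1 - b`. Here `b + k = n` is the relation between `b` and the order `k` of the
multivector, and `c` is the degree `a + b - (n - 1)` of the bracket. The contraction does not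
depend on the representative of the class `♯_{b+1}(dβ)`, see `bracket_eq`. -/
def bracket {a b c k : ℕ} (_hk : b + k = n) (hc : k + c = a + 1)
    (α : Form E M a) (β : Form E M b) (hβ : D.IsHamiltonian b β) : Form E M c :=
  fun x => (-1 : ℝ) ^ (n - 1 - b) • interior hc (D.sharpRep k x ⟨d β x, hβ.2.2 x⟩) (d α x)

/-- Contracting a form of `S^{p+c}` with `c` vectors gives a form of `S^p`. -/
theorem slice_mem {p : ℕ} (hp : 1 ≤ p) (x : M) : ∀ (c : ℕ), p + c ≤ n → ∀ (α : Alt E (p + c)),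
    α ∈ D.S (p + c) x → ∀ w : Fin c → E, slice α w ∈ D.S p x := by
  intro c
  induction c with
  | zero =>
    intro _ α hα w
    have : slice α w = α := by
      ext v
      rw [slice_apply]
      congr 1
      funext i
      exact Fin.append_left v w i
    rw [this]; exact hα
  | succ c ih =>
    intro hc α hα w
    have hmem : (α.curryLeft (w (Fin.last c)) : Alt E (p + c)) ∈ D.S (p + c) x := by
      rw [D.contraction (p + c) (by omega) (by omega) x]
      exact Submodule.subset_span ⟨α, hα, _, rfl⟩
    have h2 := ih (by omega) _ hmem (Fin.init w)
    have : slice α w = ((Equiv.Perm.sign (finRotate (p + c + 1)) : ℤ) : ℝ) •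
        slice (α.curryLeft (w (Fin.last c)) : Alt E (p + c)) (Fin.init w) := by
      refine ContinuousAlternatingMap.ext fun (v : Fin p → E) => ?_
      have e : (@Fin.append p (c+1) E v w : Fin (p + c + 1) → E)
          = (fun i => (Fin.cons (w (Fin.last c)) (Fin.append v (Fin.init (α := fun _ => E) w)) :
            Fin (p + c + 1) → E) (finRotate (p + c + 1) i)) := by
        rw [← Fin.snoc_eq_cons_rotate]
        conv_lhs => rw [← Fin.snoc_init_self w]
        exact Fin.append_snoc v (Fin.init w) (w (Fin.last c))
      have h3 := AlternatingMap.map_perm (α.toAlternatingMap)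
        (Fin.cons (w (Fin.last c)) (Fin.append v (Fin.init w)) : Fin (p + c + 1) → E)
        (finRotate (p + c + 1))
      have h4 : slice α w v = α.toAlternatingMap ((Fin.cons (w (Fin.last c))
          (Fin.append v (Fin.init w)) : Fin (p + c + 1) → E) ∘ (finRotate (p + c + 1))) :=
        congrArg α e
      rw [h4, h3, Units.smul_def, zsmul_eq_mul]
      rfl
    rw [this]
    exact Submodule.smul_mem _ _ h2

/-- The bracket may be computed with any representative `V` of the class `♯_{b+1}(dβ)`. -/
theorem bracket_eq {a b c k : ℕ} (hk : b + k = n) (hc : k + c = a + 1)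
    (α : Form E M a) (β : Form E M b) (hα : D.IsHamiltonian a α) (hβ : D.IsHamiltonian b β)
    (x : M) (V : MVec E k) (hV : D.sharp (b + 1) k x ⟨d β x, hβ.2.2 x⟩ = Submodule.Quotient.mk V) :
    D.bracket hk hc α β hβ x = (-1 : ℝ) ^ (n - 1 - b) • interior hc V (d α x) := by
  have h1 := (Submodule.Quotient.mk_surjective _ (D.sharp (b+1) k x ⟨d β x, hβ.2.2 x⟩)).choose_spec
  have h2 := (Submodule.Quotient.eq _).1 (h1.trans hV)
  have ha := hα.1
  have hb := hβ.1
  unfold bracket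
  congr 1
  ext w
  have : ∀ (e : ℕ) (h : k + c = e) (σ : Alt E e), σ ∈ D.S e x → e ≤ n →
      slice (castDeg h.symm σ) w ∈ D.S k x := by
    intro e h σ hσ he
    subst h
    exact D.slice_mem (by omega) x c he σ hσ w
  have h3 := (Submodule.mem_dualAnnihilator _).1 h2 _ (this _ hc _ (hα.2.2 x) ha)
  simp only [LinearMap.sub_apply, sub_eq_zero] at h3
  exact h3

end GradedDirac

end Dirac

/-! ### Fibered graded Dirac structures -/

section Fibered

variable {E : Type*} [NormedAddCommGroup E] [NormedSpace ℝ E] [FiniteDimensional ℝ E]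
  {M : Type*} [TopologicalSpace M] [ChartedSpace E M]
  {F : Type*} [NormedAddCommGroup F] [NormedSpace ℝ F] [FiniteDimensional ℝ F]
  {X : Type*} [TopologicalSpace X] [ChartedSpace F X]

/-- The differential of `τ : M → X` at `x`. -/
def dmap (E F : Type*) [NormedAddCommGroup E] [NormedSpace ℝ E] [NormedAddCommGroup F]
    [NormedSpace ℝ F] {M X : Type*} [TopologicalSpace M] [ChartedSpace E M] [TopologicalSpace X]
    [ChartedSpace F X] (τ : M → X) (x : M) : E →L[ℝ] F :=
  mfderiv 𝓘(ℝ, E) 𝓘(ℝ, F) τ x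

/-- `τ : M → X` is a fibered manifold: a smooth surjective submersion. -/
structure IsFiberedManifold (E F : Type*) [NormedAddCommGroup E] [NormedSpace ℝ E]
    [NormedAddCommGroup F] [NormedSpace ℝ F] {M X : Type*} [TopologicalSpace M]
    [ChartedSpace E M] [TopologicalSpace X] [ChartedSpace F X] (τ : M → X) : Prop where
  smooth : ContMDiff 𝓘(ℝ, E) 𝓘(ℝ, F) ∞ τ
  surjective : Function.Surjective τ
  submersion : ∀ x, Function.Surjective (dmap E F τ x)

/-- `ε` is basic: `ε = τ^* η` for a smooth form `η` on `X`. -/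
def IsBasic (F : Type*) [NormedAddCommGroup F] [NormedSpace ℝ F] {X : Type*} [TopologicalSpace X]
    [ChartedSpace F X] (τ : M → X) {b : ℕ} (ε : Form E M b) : Prop :=
  ∃ η : Form F X b, SmoothForm η ∧
    ∀ x, ε x = (η (τ x)).compContinuousLinearMap (dmap E F τ x)

/-- `ε` is closed and basic. -/
def IsClosedBasic (F : Type*) [NormedAddCommGroup F] [NormedSpace ℝ F] {X : Type*}
    [TopologicalSpace X] [ChartedSpace F X] (τ : M → X) {b : ℕ} (ε : Form E M b) : Prop :=
  IsBasic F τ ε ∧ d ε = 0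

namespace GradedDirac

variable {n : ℕ} (D : GradedDirac E M n)

/-- The graded Dirac structure is fibered over `X`: each `S^a` consists of `(a-1)`-horizontal
forms and contains all semi-basic `a`-forms. -/
structure IsFibered (F : Type*) [NormedAddCommGroup F] [NormedSpace ℝ F] {X : Type*}
    [TopologicalSpace X] [ChartedSpace F X] (τ : M → X) : Prop where
  horizontal : ∀ a, 1 ≤ a → a ≤ n → ∀ x, ∀ α ∈ D.S a x, IsHorizontal (dmap E F τ x) (a - 1) α
  semibasic : ∀ a, 1 ≤ a → a ≤ n → ∀ x, ∀ α : Alt E a, IsSemibasic (dmap E F τ x) α → α ∈ D.S a x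

/-- `♯_n : S^n → TM / K_1` takes vertical values: if `♯_n(α)` is the class of the tangent vector
`v`, then `v` is vertical. -/
def SharpVertical (F : Type*) [NormedAddCommGroup F] [NormedSpace ℝ F] {X : Type*}
    [TopologicalSpace X] [ChartedSpace F X] (τ : M → X) : Prop :=
  ∀ (x : M) (α : D.S n x) (v : E) (U : MVec E 1), (∀ σ : Alt E 1, U σ = σ (fun _ => v)) →
    D.sharp n 1 x α = Submodule.Quotient.mk U → dmap E F τ x v = 0

/-- `α` is a special Hamiltonian `a`-form: it is Hamiltonian, and `α ∧ ε ∈ Ω^{n-1}_H(M)` for every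
closed basic form `ε` of degree `c = n - 1 - a`. -/
def IsSpecial (F : Type*) [NormedAddCommGroup F] [NormedSpace ℝ F] {X : Type*}
    [TopologicalSpace X] [ChartedSpace F X] (τ : M → X) (a : ℕ) (α : Form E M a) : Prop :=
  D.IsHamiltonian a α ∧ ∀ c : ℕ, a + c + 1 = n → ∀ ε : Form E M c, IsClosedBasic F τ ε →
    D.IsHamiltonian (a + c) (wedgeF α ε)

end GradedDirac

end Fibered

end GDirac

end

open GDirac

/-! Write `γ = {α, β}`, of degree `c`, and `p = n-1-a`, `q = n-1-b`, so that the degree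
complementary to `c` in `n-1` is `p + q`. The bracket of two special forms is Hamiltonian by
integrability: `dα` and `dβ` are closed and skew symmetry identifies their two mutual contractions,
so the form `θ` collapses to `± d ι_V dα` (`IsHamiltonian.bracket`). It remains to see that `dγ ∧ ε`
lies in `S^n` for closed basic `ε` of degree `p + q`.

For closed basic `e₁`, `e₂` of degrees `p`, `q`, the `(n-1)`-forms `α ∧ e₁` and `β ∧ e₂` are again
special, so their bracket is Hamiltonian. By `exists_bracket_wdF` that bracket is a nonzero constant
times `γ ∧ e₂ ∧ e₁`; differentiating, `dγ ∧ e₂ ∧ e₁` lies in `S^n`. Closed basic forms take every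
semi-basic value at a given point (`exists_isClosedBasic`), and the products of semi-basic `q`- and
`p`-forms span the semi-basic `(p+q)`-forms, which suffices because `S^n` is linear
(`wd_mem_of_wd_wd_mem`).

The bracket identity is pointwise algebra. The vector `ι_{e₂} V` is vertical, since a nonzero
multiple of it represents `♯(dβ ∧ e₂)`; contraction with it therefore passes over `e₁`, and one must
compare `X_ε = ι_{ι_ε V} dα` with `(ι_V dα) ∧ ε`. Skew symmetry in degree `n` together with the
perfect pairing of semi-basic forms shows that `l ∧ ε = 0` forces `l ∧ X_ε = 0`
(`covecWedge_interior_eq_zero`). A linear map `ε ↦ X_ε` with this property is exterior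
multiplication by a fixed form, and `exists_wd_interior` identifies that form as a multiple of `ι_V
dα`. The identification rests on a count: `V` annihilates semi-basic forms and `dα` has vertical
degree at most one, so exactly one factor of `V` acts vertically. The factor depends on the degrees
alone, hence is constant on `M`.

When `n = 1` the complementary degree is zero and only the Hamiltonian property is needed. -/

set_option linter.unusedSectionVars false

noncomputable section

namespace GDirac

/-! ### Sums over all permutations of the arguments. -/

section Alternation

variable {E : Type*}

/-- The signed sum of a function of `n` vectors over all permutations of its arguments. -/
def altSum {n : ℕ} (G : (Fin n → E) → ℝ) (v : Fin n → E) : ℝ :=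
  ∑ σ : Equiv.Perm (Fin n), ((Equiv.Perm.sign σ : ℤ) : ℝ) * G (v ∘ σ)

theorem altSum_comp_perm {n : ℕ} (G : (Fin n → E) → ℝ) (τ : Equiv.Perm (Fin n)) :
    altSum (fun v => G (v ∘ τ)) = ((Equiv.Perm.sign τ : ℤ) : ℝ) • altSum G := by
  funext v
  simp only [altSum, Pi.smul_apply, smul_eq_mul, Finset.mul_sum]
  refine Fintype.sum_equiv (Equiv.mulRight τ) _ _ fun σ => ?_
  have h : ((Equiv.Perm.sign τ : ℤ) : ℝ) * ((Equiv.Perm.sign τ : ℤ) : ℝ) = 1 := by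
    rw [← Int.cast_mul, ← Units.val_mul, Int.units_mul_self]; simp
  simp only [Equiv.coe_mulRight, Equiv.Perm.sign_mul, Units.val_mul, Int.cast_mul,
    Equiv.Perm.coe_mul, Function.comp_assoc]
  linear_combination -(((Equiv.Perm.sign σ : ℤ) : ℝ) * G (v ∘ ⇑σ ∘ ⇑τ)) * h

theorem altSum_smul {n : ℕ} (r : ℝ) (G : (Fin n → E) → ℝ) :
    altSum (fun v => r * G v) = r • altSum G := by
  funext v
  simp only [altSum, Pi.smul_apply, smul_eq_mul, Finset.mul_sum]
  exact Finset.sum_congr rfl fun σ _ => by ring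

theorem altSum_sum {n : ℕ} {ι : Type*} (s : Finset ι) (G : ι → (Fin n → E) → ℝ) :
    altSum (fun v => ∑ i ∈ s, G i v) = ∑ i ∈ s, altSum (G i) := by
  funext v
  simp only [altSum, Finset.sum_apply, Finset.mul_sum]
  rw [Finset.sum_comm]

/-- Alternating over a subgroup of permutations first only multiplies the result by the order of
the subgroup. -/
theorem altSum_nested {m n : ℕ} (ι : Equiv.Perm (Fin m) → Equiv.Perm (Fin n))
    (hι : ∀ σ, Equiv.Perm.sign (ι σ) = Equiv.Perm.sign σ) (K : (Fin n → E) → ℝ) :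
    altSum (fun v => ∑ σ : Equiv.Perm (Fin m), ((Equiv.Perm.sign σ : ℤ) : ℝ) * K (v ∘ ι σ))
      = (m.factorial : ℝ) • altSum K := by
  rw [altSum_sum]
  have : ∀ σ : Equiv.Perm (Fin m),
      altSum (fun v => ((Equiv.Perm.sign σ : ℤ) : ℝ) * K (v ∘ ι σ)) = altSum K := by
    intro σ
    rw [altSum_smul, altSum_comp_perm, hι, smul_smul, ← Int.cast_mul, ← Units.val_mul,
      Int.units_mul_self]
    simp
  simp only [this, Finset.sum_const, Finset.card_univ, Fintype.card_perm, Fintype.card_fin,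
    ← Nat.cast_smul_eq_nsmul ℝ]

/-- The inner alternation runs over the permutations that move the first block only, and these keep
their sign when extended by the identity, so `altSum_nested` applies. -/
theorem altSum_append_left {a b : ℕ} (G : (Fin a → E) → ℝ) (H : (Fin b → E) → ℝ) :
    altSum (fun v : Fin (a + b) → E => altSum G (v ∘ Fin.castAdd b) * H (v ∘ Fin.natAdd a))
      = (a.factorial : ℝ) •
        altSum (fun v : Fin (a + b) → E => G (v ∘ Fin.castAdd b) * H (v ∘ Fin.natAdd a)) := by
  rw [← altSum_nested (fun σ => finSumFinEquiv.permCongr (Equiv.Perm.sumCongr σ 1))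
    (by intro σ; simp)]
  congr 1
  funext v
  simp only [altSum, Finset.sum_mul]
  refine Finset.sum_congr rfl fun σ _ => ?_
  rw [mul_assoc]
  congr 3
  · funext i; simp [Equiv.permCongr_apply]
  · funext i; simp [Equiv.permCongr_apply]

theorem altSum_append_right {a b : ℕ} (G : (Fin a → E) → ℝ) (H : (Fin b → E) → ℝ) :
    altSum (fun v : Fin (a + b) → E => G (v ∘ Fin.castAdd b) * altSum H (v ∘ Fin.natAdd a))
      = (b.factorial : ℝ) •
        altSum (fun v : Fin (a + b) → E => G (v ∘ Fin.castAdd b) * H (v ∘ Fin.natAdd a)) := by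
  rw [← altSum_nested (fun σ => finSumFinEquiv.permCongr (Equiv.Perm.sumCongr 1 σ))
    (by intro σ; simp)]
  congr 1
  funext v
  simp only [altSum, Finset.mul_sum]
  refine Finset.sum_congr rfl fun σ _ => ?_
  rw [mul_left_comm]
  congr 3
  · funext i; simp [Equiv.permCongr_apply]
  · funext i; simp [Equiv.permCongr_apply]

theorem altSum_tail {a : ℕ} (l : E → ℝ) (G : (Fin a → E) → ℝ) :
    altSum (fun v : Fin (a + 1) → E => l (v 0) * altSum G (v ∘ Fin.succ))
      = (a.factorial : ℝ) •
        altSum (fun v : Fin (a + 1) → E => l (v 0) * G (v ∘ Fin.succ)) := by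
  -- The permutation that fixes `0` and acts by `σ` on the successors.
  rw [← altSum_nested (fun σ => Equiv.Perm.decomposeFin.symm (0, σ))
    (by intro σ; simp [Equiv.Perm.decomposeFin.symm_sign])]
  congr 1
  funext v
  simp only [altSum, Finset.mul_sum]
  refine Finset.sum_congr rfl fun σ _ => ?_
  rw [mul_left_comm]
  congr 3

theorem altSum_comp_cast {a b : ℕ} (h : a = b) (G : (Fin a → E) → ℝ) (v : Fin b → E) :
    altSum G (v ∘ Fin.cast h) = altSum (fun w : Fin b → E => G (w ∘ Fin.cast h)) v := by
  subst h; rfl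

end Alternation

/-! ### Exterior products as normalised alternations; associativity with a covector. -/

section Wedge

variable {E : Type*} [NormedAddCommGroup E] [NormedSpace ℝ E]

theorem altSum_coe {a : ℕ} (α : Alt E a) : altSum (⇑α) = (a.factorial : ℝ) • ⇑α := by
  funext v
  have : ∀ σ : Equiv.Perm (Fin a), ((Equiv.Perm.sign σ : ℤ) : ℝ) * α (v ∘ σ) = α v := by
    intro σ
    have h := AlternatingMap.map_perm α.toAlternatingMap v σ
    have h' : α (v ∘ σ) = ((Equiv.Perm.sign σ : ℤ) : ℝ) * α v := by
      rw [Units.smul_def, zsmul_eq_mul] at h; exact h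
    rw [h', ← mul_assoc, ← Int.cast_mul, ← Units.val_mul, Int.units_mul_self]
    simp
  simp [altSum, this, Fintype.card_perm]

/-- The exterior product `l ∧ α` of a covector and a form. -/
def covecWedge {a : ℕ} (l : E →L[ℝ] ℝ) (α : Alt E a) : Alt E (a + 1) :=
  ContinuousAlternatingMap.alternatizeUncurryFin (l.smulRight α)

theorem covecWedge_apply {a : ℕ} (l : E →L[ℝ] ℝ) (α : Alt E a) (v : Fin (a + 1) → E) :
    covecWedge l α v = ∑ i : Fin (a + 1), (-1 : ℝ) ^ (i : ℕ) * (l (v i) * α (i.removeNth v)) := by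
  simp [covecWedge, ContinuousAlternatingMap.alternatizeUncurryFin_apply]

/-- The `i`-th term of `l ∧ α` is `l ⊗ α` precomposed with a cycle of sign `(-1)^i`, so all `a + 1`
terms have the same alternation; the alternation of `l ∧ α` itself is `(a + 1)!` times it. -/
theorem altSum_covecWedge {a : ℕ} (l : E →L[ℝ] ℝ) (α : Alt E a) :
    altSum (fun v : Fin (a + 1) → E => l (v 0) * α (v ∘ Fin.succ))
      = (a.factorial : ℝ) • ⇑(covecWedge l α) := by
  have h1 : ⇑(covecWedge l α) = fun v => ∑ i : Fin (a + 1), (-1 : ℝ) ^ (i : ℕ) *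
      (fun v : Fin (a + 1) → E => l (v 0) * α (v ∘ Fin.succ)) (v ∘ i.cycleRange.symm) := by
    funext v
    rw [covecWedge_apply]
    refine Finset.sum_congr rfl fun i _ => ?_
    have : i.removeNth v = (v ∘ i.cycleRange.symm) ∘ Fin.succ := by
      funext j; simp [Fin.removeNth]
    simp [this]
  have h2 := altSum_coe (covecWedge l α)
  have h3 : altSum ⇑(covecWedge l α) = ((a : ℝ) + 1) •
      altSum (fun v : Fin (a + 1) → E => l (v 0) * α (v ∘ Fin.succ)) := by
    conv_lhs => rw [h1]
    rw [altSum_sum]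
    have : ∀ i : Fin (a + 1), altSum (fun v : Fin (a + 1) → E => (-1 : ℝ) ^ (i : ℕ) *
        (fun v : Fin (a + 1) → E => l (v 0) * α (v ∘ Fin.succ)) (v ∘ i.cycleRange.symm))
        = altSum (fun v : Fin (a + 1) → E => l (v 0) * α (v ∘ Fin.succ)) := by
      intro i
      rw [altSum_smul,
        altSum_comp_perm (fun v : Fin (a + 1) → E => l (v 0) * α (v ∘ Fin.succ)),
        smul_smul, Equiv.Perm.sign_symm, Fin.sign_cycleRange]
      simp [← pow_add, ← two_mul]
    simp only [this, Finset.sum_const, Finset.card_univ, Fintype.card_fin,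
      ← Nat.cast_smul_eq_nsmul ℝ]
    push_cast; rfl
  rw [h3, Nat.factorial_succ] at h2
  have h4 : ((a : ℝ) + 1) ≠ 0 := by positivity
  push_cast at h2
  rw [mul_smul] at h2
  exact smul_right_injective _ h4 h2

/-- Replaces the sum over shuffles by a sum over all permutations, where reindexing is easy.
Identities between wedge products are then checked after multiplication by nonzero factorials. -/
theorem altSum_wedge [FiniteDimensional ℝ E] {a b : ℕ} (α : Alt E a) (β : Alt E b) :
    altSum (fun v : Fin (a + b) → E => α (v ∘ Fin.castAdd b) * β (v ∘ Fin.natAdd a))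
      = ((a.factorial : ℝ) * b.factorial) • ⇑(wedge α β) := by
  have h := MultilinearMap.domCoprod_alternization_eq α.toAlternatingMap β.toAlternatingMap
  simp only [Fintype.card_fin] at h
  funext v
  have h2 := congrArg (fun f => LinearMap.mul' ℝ ℝ (f (v ∘ finSumFinEquiv))) h
  simp only [MultilinearMap.alternatization_apply, AlternatingMap.smul_apply, map_nsmul, map_sum] at h2
  rw [Pi.smul_apply]
  have h3 : wedge α β v = LinearMap.mul' ℝ ℝ ((α.toAlternatingMap.domCoprod β.toAlternatingMap)
      (v ∘ finSumFinEquiv)) := rfl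
  rw [h3, ← Nat.cast_mul, Nat.cast_smul_eq_nsmul, ← h2]
  unfold altSum
  refine Fintype.sum_equiv finSumFinEquiv.symm.permCongr _ _ fun σ => ?_
  rw [Units.smul_def, map_zsmul, zsmul_eq_mul, Equiv.Perm.sign_permCongr]
  congr 1
  simp only [MultilinearMap.domDomCongr_apply, MultilinearMap.domCoprod_apply,
    LinearMap.mul'_apply]
  congr 1
  · change α _ = α _
    congr 1; funext i; simp [Equiv.permCongr_apply]
  · change β _ = β _
    congr 1; funext i; simp [Equiv.permCongr_apply]

theorem castDeg_apply {a b : ℕ} (h : a = b) (α : Alt E a) (v : Fin b → E) :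
    castDeg h α v = α (v ∘ Fin.cast h) := by
  subst h; rfl

/-- The exterior product, with the degree of the result given up to an equality. -/
def wd [FiniteDimensional ℝ E] {a b c : ℕ} (h : a + b = c) (α : Alt E a) (β : Alt E b) : Alt E c :=
  castDeg h (wedge α β)

variable [FiniteDimensional ℝ E]

theorem altSum_wd {a b c : ℕ} (h : a + b = c) (α : Alt E a) (β : Alt E b) :
    altSum (fun v : Fin c → E => α (v ∘ Fin.cast h ∘ Fin.castAdd b) *
      β (v ∘ Fin.cast h ∘ Fin.natAdd a)) = ((a.factorial : ℝ) * b.factorial) • ⇑(wd h α β) := by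
  subst h
  exact altSum_wedge α β

theorem altSum_covecWedge_wedge {a b : ℕ} (l : E →L[ℝ] ℝ) (α : Alt E a) (β : Alt E b) :
    altSum (fun v : Fin (a + b + 1) → E => l (v 0) *
        (α (v ∘ Fin.succ ∘ Fin.castAdd b) * β (v ∘ Fin.succ ∘ Fin.natAdd a)))
      = ((a.factorial : ℝ) * b.factorial) • ⇑(covecWedge l (wedge α β)) := by
  have h1 := altSum_tail (E := E) (fun x => l x)
    (fun v : Fin (a + b) → E => α (v ∘ Fin.castAdd b) * β (v ∘ Fin.natAdd a))
  rw [altSum_wedge] at h1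
  simp only [Pi.smul_apply, smul_eq_mul, mul_left_comm (l _) _ _] at h1
  rw [altSum_smul, altSum_covecWedge] at h1
  have h2 := smul_right_injective _ (Nat.cast_ne_zero (R := ℝ).2 (Nat.factorial_ne_zero _))
    ((smul_comm _ _ _).trans h1)
  simp only [mul_left_comm _ (l _) _]  at h2
  exact h2.symm

/-- Both sides are multiples of the full alternation of `l ⊗ α ⊗ β`. Since semi-basic forms are
built up from covectors, associativity is only ever needed with a covector or a function as one of
the factors. -/
theorem covecWedge_wd {a b c : ℕ} (h : a + b = c) (h' : a + 1 + b = c + 1) (l : E →L[ℝ] ℝ)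
    (α : Alt E a) (β : Alt E b) : wd h' (covecWedge l α) β = covecWedge l (wd h α β) := by
  subst h
  have e1 : ((a.factorial : ℝ) * ((a + 1).factorial * b.factorial)) •
      ⇑(wd h' (covecWedge l α) β) = ((a + 1).factorial : ℝ) •
        altSum (fun v : Fin (a + b + 1) → E => l (v 0) *
          (α (v ∘ Fin.succ ∘ Fin.castAdd b) * β (v ∘ Fin.succ ∘ Fin.natAdd a))) := by
    have h1 := altSum_append_left (E := E) (a := a + 1) (b := b)
      (fun v => l (v 0) * α (v ∘ Fin.succ)) (⇑β)
    rw [altSum_covecWedge] at h1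
    simp only [Pi.smul_apply, smul_eq_mul, mul_assoc] at h1
    rw [altSum_smul, altSum_wedge] at h1
    funext v
    have h2 := congrFun h1 (v ∘ Fin.cast h')
    rw [Pi.smul_apply, Pi.smul_apply, Pi.smul_apply, altSum_comp_cast h'] at h2
    simp only [Pi.smul_apply, smul_eq_mul, wd, castDeg_apply] at h2 ⊢
    rw [mul_assoc, h2]
    congr 2
    funext w
    congr 2
    congr 1
    funext i
    simp only [Function.comp_apply]
    congr 1
    ext
    simp
    omega
  have e2 : ((a.factorial : ℝ) * ((a + 1).factorial * b.factorial)) •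
      ⇑(covecWedge l (wd rfl α β)) = ((a + 1).factorial : ℝ) •
        altSum (fun v : Fin (a + b + 1) → E => l (v 0) *
          (α (v ∘ Fin.succ ∘ Fin.castAdd b) * β (v ∘ Fin.succ ∘ Fin.natAdd a))) := by
    rw [altSum_covecWedge_wedge, smul_smul, mul_left_comm]
    rfl
  have h3 : ((a.factorial : ℝ) * ((a + 1).factorial * b.factorial)) ≠ 0 := by positivity
  exact DFunLike.coe_injective (smul_right_injective _ h3 (e1.trans e2.symm))

theorem wd_covecWedge {a b c : ℕ} (h : a + b = c) (h' : a + (b + 1) = c + 1) (l : E →L[ℝ] ℝ)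
    (α : Alt E a) (β : Alt E b) :
    wd h' α (covecWedge l β) = (-1 : ℝ) ^ a • covecWedge l (wd h α β) := by
  subst h
  have e1 : ((b.factorial : ℝ) * (a.factorial * (b + 1).factorial)) •
      ⇑(wd h' α (covecWedge l β)) = ((b + 1).factorial : ℝ) • (-1 : ℝ) ^ a • 
        altSum (fun v : Fin (a + b + 1) → E => l (v 0) *
          (α (v ∘ Fin.succ ∘ Fin.castAdd b) * β (v ∘ Fin.succ ∘ Fin.natAdd a))) := by
    have h1 := altSum_append_right (E := E) (a := a) (b := b + 1) (⇑α)
      (fun v => l (v 0) * β (v ∘ Fin.succ)) 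
    rw [altSum_covecWedge] at h1
    simp only [Pi.smul_apply, smul_eq_mul, mul_left_comm (α _)] at h1
    rw [altSum_smul, altSum_wedge] at h1
    rw [mul_smul]
    refine h1.trans ?_
    congr 1
    -- The cycle exchanging position `a` of the argument of `l` for position `0`, past the `a`
    -- arguments of `α`; its sign is `(-1)^a`.
    have h2 := altSum_comp_perm (fun v : Fin (a + b + 1) → E => l (v 0) *
          (α (v ∘ Fin.succ ∘ Fin.castAdd b) * β (v ∘ Fin.succ ∘ Fin.natAdd a)))
        (Fin.cycleRange (⟨a, by omega⟩ : Fin (a + b + 1))).symm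
    rw [Equiv.Perm.sign_symm, Fin.sign_cycleRange] at h2
    push_cast at h2
    rw [← h2]
    congr 1
    funext v
    simp only [Function.comp_apply, Fin.cycleRange_symm_zero, Function.comp_def,
      Fin.cycleRange_symm_succ]
    congr 1
    congr 2
    · funext i
      congr 1
      rw [Fin.succAbove_of_castSucc_lt]
      · rfl
      · simp [Fin.lt_def]
    · funext i
      congr 1
      rw [Fin.succAbove_of_le_castSucc]
      · ext; simp; omega
      · simp [Fin.le_def]
  have e2 := altSum_covecWedge_wedge l α β
  have h3 : ((b.factorial : ℝ) * (a.factorial * (b + 1).factorial)) ≠ 0 := by positivity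
  refine DFunLike.coe_injective (smul_right_injective _ h3 (e1.trans ?_))
  rw [e2]
  simp only [ContinuousAlternatingMap.coe_smul, smul_smul, wd, castDeg]
  congr 1
  ring

end Wedge

/-! ### Exterior multiplication by covectors and contraction with vectors. -/

section CovectorWedge

variable {E : Type*} [NormedAddCommGroup E] [NormedSpace ℝ E]

theorem covecWedge_add {a : ℕ} (l : E →L[ℝ] ℝ) (α β : Alt E a) :
    covecWedge l (α + β) = covecWedge l α + covecWedge l β := by
  ext v
  simp [covecWedge_apply, mul_add, Finset.sum_add_distrib]

theorem covecWedge_smul {a : ℕ} (l : E →L[ℝ] ℝ) (r : ℝ) (α : Alt E a) :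
    covecWedge l (r • α) = r • covecWedge l α := by
  ext v
  simp only [covecWedge_apply, ContinuousAlternatingMap.smul_apply, smul_eq_mul, Finset.mul_sum]
  exact Finset.sum_congr rfl fun i _ => by ring

theorem add_covecWedge {a : ℕ} (l m : E →L[ℝ] ℝ) (α : Alt E a) :
    covecWedge (l + m) α = covecWedge l α + covecWedge m α := by
  ext v
  simp [covecWedge_apply, mul_add, add_mul, Finset.sum_add_distrib]

theorem smul_covecWedge {a : ℕ} (r : ℝ) (l : E →L[ℝ] ℝ) (α : Alt E a) :
    covecWedge (r • l) α = r • covecWedge l α := by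
  ext v
  simp only [covecWedge_apply, ContinuousAlternatingMap.smul_apply, smul_eq_mul, Finset.mul_sum,
    smul_apply]
  exact Finset.sum_congr rfl fun i _ => by ring

@[simp] theorem covecWedge_zero {a : ℕ} (l : E →L[ℝ] ℝ) : covecWedge l (0 : Alt E a) = 0 := by
  simpa using covecWedge_smul l 0 (0 : Alt E a)

theorem covecWedge_neg {a : ℕ} (l : E →L[ℝ] ℝ) (α : Alt E a) :
    covecWedge l (-α) = -covecWedge l α := by
  have h := covecWedge_add l α (-α)
  rw [add_neg_cancel, covecWedge_zero] at h
  exact eq_neg_of_add_eq_zero_right h.symm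

/-- Exterior multiplication by a covector, bilinearly. -/
def covecWedgeL (a : ℕ) : (E →L[ℝ] ℝ) →ₗ[ℝ] Alt E a →ₗ[ℝ] Alt E (a + 1) :=
  LinearMap.mk₂ ℝ covecWedge add_covecWedge smul_covecWedge covecWedge_add
    (fun r l α => covecWedge_smul l r α)

theorem covecWedge_sum {a : ℕ} {ι : Type*} (s : Finset ι) (l : E →L[ℝ] ℝ) (α : ι → Alt E a) :
    covecWedge l (∑ i ∈ s, α i) = ∑ i ∈ s, covecWedge l (α i) :=
  map_sum (covecWedgeL a l) α s

theorem curryLeft_covecWedge_zero (l : E →L[ℝ] ℝ) (α : Alt E 0) (v : E) :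
    (covecWedge l α).curryLeft v = l v • α := by
  refine ContinuousAlternatingMap.ext fun w => ?_
  rw [ContinuousAlternatingMap.curryLeft_apply_apply, covecWedge_apply,
    ContinuousAlternatingMap.smul_apply, Fin.sum_univ_succ, Finset.univ_eq_empty,
    Finset.sum_empty, Subsingleton.elim (Fin.removeNth 0 (Matrix.vecCons v w)) w]
  simp

/-- Contraction is an antiderivation: the term with `l` in the first slot gives `l v • α`, and each
other term keeps `v` as an argument of `α` and picks up one more sign. -/
theorem curryLeft_covecWedge {a : ℕ} (l : E →L[ℝ] ℝ) (α : Alt E (a + 1)) (v : E) :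
    (covecWedge l α).curryLeft v = l v • α - covecWedge l (α.curryLeft v) := by
  refine ContinuousAlternatingMap.ext fun w => ?_
  rw [ContinuousAlternatingMap.curryLeft_apply_apply, covecWedge_apply, Fin.sum_univ_succ,
    ContinuousAlternatingMap.sub_apply, covecWedge_apply, ContinuousAlternatingMap.smul_apply,
    smul_eq_mul, sub_eq_add_neg]
  congr 1
  · simp [Matrix.vecCons]
  · rw [← Finset.sum_neg_distrib]
    refine Finset.sum_congr rfl fun i _ => ?_
    have : Fin.removeNth i.succ (Matrix.vecCons v w) = Matrix.vecCons v (i.removeNth w) := by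
      funext j
      refine Fin.cases ?_ (fun k => ?_) j
      · simp [Fin.removeNth]
      · simp [Fin.removeNth]
    rw [this, ContinuousAlternatingMap.curryLeft_apply_apply]
    simp [pow_succ]

theorem eq_of_curryLeft_eq {a : ℕ} {α β : Alt E (a + 1)}
    (h : ∀ v, α.curryLeft v = β.curryLeft v) : α = β := by
  ext v
  have := congrArg (fun f => f (Fin.tail v)) (h (v 0))
  simp only [ContinuousAlternatingMap.curryLeft_apply_apply] at this
  rwa [show (Matrix.vecCons (v 0) (Fin.tail v)) = v from Fin.cons_self_tail v] at this

/-- A form of positive degree is determined by its contractions. By the antiderivation rule,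
contracting the anticommutator applied to `α` gives the anticommutator applied to a contraction of
`α`, so induction on the degree applies. -/
theorem covecWedge_anticomm (l m : E →L[ℝ] ℝ) : ∀ {a : ℕ} (α : Alt E a),
    covecWedge l (covecWedge m α) = -covecWedge m (covecWedge l α) := by
  have key : ∀ (a : ℕ) (α : Alt E a),
      covecWedge l (covecWedge m α) + covecWedge m (covecWedge l α) = 0 := by
    intro a
    induction a with
    | zero =>
      intro α
      refine eq_of_curryLeft_eq fun v => ?_
      rw [ContinuousAlternatingMap.curryLeft_add]
      change (covecWedge l (covecWedge m α)).curryLeft v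
        + (covecWedge m (covecWedge l α)).curryLeft v = 0
      rw [curryLeft_covecWedge, curryLeft_covecWedge, curryLeft_covecWedge_zero,
        curryLeft_covecWedge_zero, covecWedge_smul, covecWedge_smul]
      abel
    | succ a ih =>
      intro α
      refine eq_of_curryLeft_eq fun v => ?_
      rw [ContinuousAlternatingMap.curryLeft_add]
      change (covecWedge l (covecWedge m α)).curryLeft v
        + (covecWedge m (covecWedge l α)).curryLeft v = 0
      rw [curryLeft_covecWedge, curryLeft_covecWedge, curryLeft_covecWedge,
        curryLeft_covecWedge, sub_eq_add_neg, sub_eq_add_neg, sub_eq_add_neg, sub_eq_add_neg,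
        covecWedge_add, covecWedge_add, covecWedge_smul, covecWedge_smul,
        ← neg_one_smul ℝ (covecWedge m (α.curryLeft v)),
        ← neg_one_smul ℝ (covecWedge l (α.curryLeft v)), covecWedge_smul, covecWedge_smul]
      have := ih (α.curryLeft v)
      rw [add_eq_zero_iff_eq_neg] at this
      rw [this]
      module
  intro a α
  exact eq_neg_of_add_eq_zero_left (key a α)

theorem covecWedge_self (l : E →L[ℝ] ℝ) {a : ℕ} (α : Alt E a) :
    covecWedge l (covecWedge l α) = 0 := by
  have := covecWedge_anticomm l l α
  have h2 : (2 : ℝ) • covecWedge l (covecWedge l α) = 0 := by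
    rw [two_smul]; nth_rewrite 1 [this]; simp
  exact (smul_eq_zero.1 h2).resolve_left two_ne_zero

end CovectorWedge

/-! ### Bilinearity, degree zero and naturality of the exterior product. -/

section WedgeDegree

variable {E : Type*} [NormedAddCommGroup E] [NormedSpace ℝ E] [FiniteDimensional ℝ E]

/-- The way a wedge product is recognised below: `a! b!` is invertible, so computing the alternation
of `α ⊗ β` is enough. -/
theorem wd_injective_aux {a b c : ℕ} (h : a + b = c) (α : Alt E a) (β : Alt E b) (γ : Alt E c)
    (hγ : altSum (fun v : Fin c → E => α (v ∘ Fin.cast h ∘ Fin.castAdd b) *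
      β (v ∘ Fin.cast h ∘ Fin.natAdd a)) = ((a.factorial : ℝ) * b.factorial) • ⇑γ) :
    wd h α β = γ := by
  rw [altSum_wd] at hγ
  have h3 : ((a.factorial : ℝ) * b.factorial) ≠ 0 := by positivity
  exact DFunLike.coe_injective (smul_right_injective _ h3 hγ)

theorem wd_add {a b c : ℕ} (h : a + b = c) (α : Alt E a) (β β' : Alt E b) :
    wd h α (β + β') = wd h α β + wd h α β' := by
  rw [wd, wedge_add, castDeg_add]; rfl

theorem wd_smul {a b c : ℕ} (h : a + b = c) (r : ℝ) (α : Alt E a) (β : Alt E b) :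
    wd h α (r • β) = r • wd h α β := by
  rw [wd, wedge_smul, castDeg_smul]; rfl

theorem add_wd {a b c : ℕ} (h : a + b = c) (α α' : Alt E a) (β : Alt E b) :
    wd h (α + α') β = wd h α β + wd h α' β := by
  refine wd_injective_aux h _ _ _ ?_
  have h1 := altSum_wd h α β
  have h2 := altSum_wd h α' β
  rw [show ⇑(wd h α β + wd h α' β) = ⇑(wd h α β) + ⇑(wd h α' β) from rfl, smul_add, ← h1, ← h2]
  funext v
  simp [altSum, add_mul, mul_add, Finset.sum_add_distrib]

theorem smul_wd {a b c : ℕ} (h : a + b = c) (r : ℝ) (α : Alt E a) (β : Alt E b) :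
    wd h (r • α) β = r • wd h α β := by
  refine wd_injective_aux h _ _ _ ?_
  rw [show ⇑(r • wd h α β) = r • ⇑(wd h α β) from rfl, smul_comm, ← altSum_wd, ← altSum_smul]
  simp only [ContinuousAlternatingMap.smul_apply, smul_eq_mul, mul_assoc]

/-- The exterior product as a bilinear map. -/
def wdL {a b c : ℕ} (h : a + b = c) : Alt E a →ₗ[ℝ] Alt E b →ₗ[ℝ] Alt E c :=
  LinearMap.mk₂ ℝ (wd h) (add_wd h) (smul_wd h) (wd_add h) (wd_smul h)

@[simp] theorem wdL_apply {a b c : ℕ} (h : a + b = c) (α : Alt E a) (β : Alt E b) :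
    wdL h α β = wd h α β := rfl

@[simp] theorem zero_wd {a b c : ℕ} (h : a + b = c) (β : Alt E b) : wd h (0 : Alt E a) β = 0 := by
  rw [← wdL_apply, map_zero, LinearMap.zero_apply]

@[simp] theorem wd_zero {a b c : ℕ} (h : a + b = c) (α : Alt E a) : wd h α (0 : Alt E b) = 0 := by
  rw [← wdL_apply, map_zero]

theorem wd_sum {a b c : ℕ} (h : a + b = c) {ι : Type*} (s : Finset ι) (α : Alt E a)
    (β : ι → Alt E b) : wd h α (∑ i ∈ s, β i) = ∑ i ∈ s, wd h α (β i) :=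
  map_sum (wdL h α) β s

theorem wd_degree_zero {a : ℕ} (α : Alt E a) (f : Alt E 0) :
    wd (Nat.add_zero a) α f = f Fin.elim0 • α := by
  refine wd_injective_aux _ _ _ _ ?_
  have h : ∀ w : Fin 0 → E, f w = f Fin.elim0 := fun w => congrArg f (Subsingleton.elim _ _)
  simp only [h _]
  have h2 := altSum_smul (f Fin.elim0) (⇑α)
  rw [altSum_coe] at h2
  simp only [mul_comm _ (f Fin.elim0)]
  refine Eq.trans h2 ?_
  rw [smul_comm]; simp

theorem degree_zero_wd {b : ℕ} (f : Alt E 0) (β : Alt E b) :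
    wd (Nat.zero_add b) f β = f Fin.elim0 • β := by
  refine wd_injective_aux _ _ _ _ ?_
  have h : ∀ w : Fin 0 → E, f w = f Fin.elim0 := fun w => congrArg f (Subsingleton.elim _ _)
  simp only [h _]
  have h2 := altSum_smul (f Fin.elim0) (⇑β)
  rw [altSum_coe] at h2
  have h3 : ∀ v : Fin b → E, v ∘ Fin.cast (Nat.zero_add b) ∘ Fin.natAdd 0 = v := by
    intro v; funext i; simp
  simp only [h3]
  refine Eq.trans h2 ?_
  rw [smul_comm]; simp

theorem wd_comp {E' : Type*} [NormedAddCommGroup E'] [NormedSpace ℝ E'] [FiniteDimensional ℝ E']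
    {a b c : ℕ} (h : a + b = c) (α : Alt E a) (β : Alt E b) (L : E' →L[ℝ] E) :
    (wd h α β).compContinuousLinearMap L
      = wd h (α.compContinuousLinearMap L) (β.compContinuousLinearMap L) := by
  refine (wd_injective_aux _ _ _ _ ?_).symm
  funext v
  have h2 := congrFun (altSum_wd h α β) (L ∘ v)
  exact h2

end WedgeDegree

section FiniteDim

variable {E : Type*} [NormedAddCommGroup E] [NormedSpace ℝ E] [FiniteDimensional ℝ E]

/-- Makes bilinear operations on forms automatically continuous, hence smooth, and gives finite
bases of forms. -/
instance finiteDimensional_alt (a : ℕ) : FiniteDimensional ℝ (Alt E a) := by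
  let f : Alt E a →ₗ[ℝ] MultilinearMap ℝ (fun _ : Fin a => E) ℝ :=
    { toFun := fun α => α.toMultilinearMap
      map_add' := fun _ _ => rfl
      map_smul' := fun _ _ => rfl }
  refine FiniteDimensional.of_injective f fun α β h => ?_
  ext v
  exact congrArg (fun g : MultilinearMap ℝ (fun _ : Fin a => E) ℝ => g v) h

end FiniteDim

/-! ### Semi-basic forms: Euler identities and the perfect pairing. -/

section Semibasic

variable {E : Type*} [NormedAddCommGroup E] [NormedSpace ℝ E]
  {F : Type*} [NormedAddCommGroup F] [NormedSpace ℝ F] (T : E →L[ℝ] F)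

/-- A covector is semi-basic if it vanishes on vertical vectors. -/
def IsSemibasicCovec (l : E →L[ℝ] ℝ) : Prop := ∀ v, T v = 0 → l v = 0

/-- A form has vertical degree at most one if it vanishes when two of its arguments are
vertical. -/
def VertDegreeLeOne {a : ℕ} (α : Alt E a) : Prop :=
  ∀ (v : Fin a → E) (i j : Fin a), i ≠ j → T (v i) = 0 → T (v j) = 0 → α v = 0

variable {T}

theorem IsHorizontal.vertDegreeLeOne {a : ℕ} {α : Alt E a} (h : IsHorizontal T (a - 1) α) :
    VertDegreeLeOne T α := by
  intro v i j hij hi hj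
  refine h v ⟨{i, j}, ?_, ?_⟩
  · rw [Finset.card_pair hij]; omega
  · intro k hk
    rcases Finset.mem_insert.1 hk with rfl | hk
    · exact hi
    · rw [Finset.mem_singleton.1 hk]; exact hj

theorem isSemibasic_of_degree_zero (α : Alt E 0) : IsSemibasic T α :=
  fun _ ⟨i, _⟩ => i.elim0

theorem isSemibasic_iff_curryLeft {a : ℕ} {α : Alt E (a + 1)} :
    IsSemibasic T α ↔ ∀ v, T v = 0 → α.curryLeft v = 0 := by
  constructor
  · intro h v hv
    refine ContinuousAlternatingMap.ext fun w => ?_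
    rw [ContinuousAlternatingMap.curryLeft_apply_apply]
    exact h _ ⟨0, by simpa using hv⟩
  · rintro h v ⟨i, hi⟩
    have h1 := congrArg (fun f => f (i.removeNth v)) (h _ hi)
    simp only [ContinuousAlternatingMap.curryLeft_apply_apply] at h1
    have h2 := AlternatingMap.map_insertNth α.toAlternatingMap i (v i) (i.removeNth v)
    rw [Fin.insertNth_self_removeNth] at h2
    change α v = (-1) ^ (i : ℕ) • α (Matrix.vecCons (v i) (i.removeNth v)) at h2
    rw [h2, h1]
    simp

theorem IsSemibasic.curryLeft {a : ℕ} {α : Alt E (a + 1)} (h : IsSemibasic T α) (u : E) :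
    IsSemibasic T (α.curryLeft u) := by
  rintro v ⟨i, hi⟩
  rw [ContinuousAlternatingMap.curryLeft_apply_apply]
  exact h _ ⟨i.succ, by simpa using hi⟩

theorem VertDegreeLeOne.curryLeft {a : ℕ} {α : Alt E (a + 1)} (h : VertDegreeLeOne T α) {u : E}
    (hu : T u = 0) : IsSemibasic T (α.curryLeft u) := by
  rintro v ⟨i, hi⟩
  rw [ContinuousAlternatingMap.curryLeft_apply_apply]
  exact h _ 0 i.succ (Fin.succ_ne_zero i).symm (by simpa using hu) (by simpa using hi)

theorem IsSemibasicCovec.covecWedge {a : ℕ} {l : E →L[ℝ] ℝ} (hl : IsSemibasicCovec T l)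
    {α : Alt E a} (hα : IsSemibasic T α) : IsSemibasic T (covecWedge l α) := by
  rintro v ⟨i, hi⟩
  rw [covecWedge_apply]
  refine Finset.sum_eq_zero fun j _ => ?_
  by_cases hij : j = i
  · subst hij; rw [hl _ hi]; simp
  · obtain ⟨k, rfl⟩ := Fin.exists_succAbove_eq (Ne.symm hij)
    rw [hα _ ⟨k, hi⟩]; simp

theorem curryLeft_add_neg_comm {a : ℕ} (α : Alt E (a + 2)) (u v : E) :
    (α.curryLeft u).curryLeft v = -(α.curryLeft v).curryLeft u := by
  have h := α.curryLeft_same (u + v)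
  rw [map_add] at h
  simp only [map_add, add_apply, ContinuousAlternatingMap.curryLeft_same,
    ContinuousAlternatingMap.curryLeft_add, zero_add, add_zero] at h
  exact eq_neg_of_add_eq_zero_right h

variable (T) in
/-- Vectors `f j` lifting a basis of the base, with the dual semi-basic covectors `φ j`. -/
structure HorizontalFrame (n : ℕ) where
  f : Fin n → E
  φ : Fin n → E →L[ℝ] ℝ
  semibasic : ∀ j, IsSemibasicCovec T (φ j)
  decomp : ∀ v, T (v - ∑ j, φ j v • f j) = 0
  dual_self : ∀ j, φ j (f j) = 1

theorem exists_horizontalFrame [FiniteDimensional ℝ F] {n : ℕ} (hn : Module.finrank ℝ F = n)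
    (hT : Function.Surjective T) : Nonempty (HorizontalFrame T n) := by
  subst hn
  let b := Module.finBasis ℝ F
  choose f hf using fun j => hT (b j)
  refine ⟨⟨f, fun j => (LinearMap.toContinuousLinearMap (b.coord j)).comp T, ?_, ?_, ?_⟩⟩
  · intro j v hv; simp [hv]
  · intro v
    rw [map_sub, map_sum, sub_eq_zero]
    simp only [map_smul, hf]
    exact (b.sum_repr (T v)).symm
  · intro j; simp [hf]

namespace HorizontalFrame

variable {n : ℕ} (Φ : HorizontalFrame T n)

theorem covec_eq {l : E →L[ℝ] ℝ} (hl : IsSemibasicCovec T l) : l = ∑ j, l (Φ.f j) • Φ.φ j := by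
  ext v
  have := hl _ (Φ.decomp v)
  rw [map_sub, map_sum, sub_eq_zero] at this
  rw [this]
  simp [mul_comm]

/-- Alternating `v ↦ ι_v η` multiplies `η` by its degree. As `η` is semi-basic, `ι_v η` sees only
the part of `v` in the span of the frame, which turns the alternation into the sum over `j`. -/
theorem euler {a : ℕ} {η : Alt E (a + 1)} (hη : IsSemibasic T η) :
    ∑ j, covecWedge (Φ.φ j) (η.curryLeft (Φ.f j)) = ((a : ℝ) + 1) • η := by
  have h1 : η.curryLeft = ∑ j, (Φ.φ j).smulRight (η.curryLeft (Φ.f j)) := by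
    refine ContinuousLinearMap.ext fun v => ?_
    have := (isSemibasic_iff_curryLeft.1 hη) _ (Φ.decomp v)
    rw [map_sub, map_sum, sub_eq_zero] at this
    rw [this]
    simp
  have h2 := ContinuousAlternatingMap.alternatizeUncurryFin_curryLeft η
  rw [h1, ← ContinuousAlternatingMap.alternatizeUncurryFinCLM_apply, map_sum] at h2
  refine h2.trans ?_
  rw [← Nat.cast_smul_eq_nsmul ℝ]
  push_cast
  rfl

/-- The antiderivation rule gives `n • η` minus the Euler sum, which counts the degree. -/
theorem contraction_wedge : ∀ {a : ℕ} {η : Alt E a} (_ : IsSemibasic T η),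
    ∑ j, (covecWedge (Φ.φ j) η).curryLeft (Φ.f j) = ((n : ℝ) - a) • η
  | 0, η, _ => by
    simp [curryLeft_covecWedge_zero, Φ.dual_self, ← Nat.cast_smul_eq_nsmul ℝ]
  | a + 1, η, hη => by
    simp only [curryLeft_covecWedge, Φ.dual_self, one_smul, Finset.sum_sub_distrib, Φ.euler hη]
    rw [Finset.sum_const, Finset.card_univ, Fintype.card_fin, ← Nat.cast_smul_eq_nsmul ℝ]
    push_cast
    rw [← sub_smul]

theorem eq_zero_of_covecWedge (Φ : HorizontalFrame T n) {a : ℕ} (ha : a < n) {η : Alt E a} (hη : IsSemibasic T η)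
    (h : ∀ l, IsSemibasicCovec T l → covecWedge l η = 0) : η = 0 := by
  have h1 := Φ.contraction_wedge hη
  simp only [h _ (Φ.semibasic _), ContinuousAlternatingMap.curryLeft_zero,
    zero_apply, Finset.sum_const_zero] at h1
  have h2 : ((n : ℝ) - a) ≠ 0 := by
    have : (a : ℝ) < n := by exact_mod_cast ha
    linarith
  exact (smul_eq_zero.1 h1.symm).resolve_left h2

/-- Euler's identity, divided by the degree, writes `η` as a combination of products `l ∧ η'` with
semi-basic factors. -/
theorem semibasic_induction (Φ : HorizontalFrame T n) {a : ℕ} {P : Alt E (a + 1) → Prop} (h0 : P 0)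
    (hadd : ∀ x y, P x → P y → P (x + y)) (hsmul : ∀ (r : ℝ) x, P x → P (r • x))
    (hw : ∀ l, IsSemibasicCovec T l → ∀ η, IsSemibasic T η → P (covecWedge l η))
    {η : Alt E (a + 1)} (hη : IsSemibasic T η) : P η := by
  have h1 := Φ.euler hη
  have h2 : ((a : ℝ) + 1) ≠ 0 := by positivity
  rw [← inv_smul_smul₀ h2 η, ← h1]
  exact hsmul _ _ (Finset.sum_induction _ P hadd h0 fun j _ => hw _ (Φ.semibasic j) _ (hη.curryLeft _))

end HorizontalFrame

variable [FiniteDimensional ℝ E] {n : ℕ}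

/-- Wedging with semi-basic forms is a perfect pairing. -/
theorem HorizontalFrame.eq_zero_of_wd (Φ : HorizontalFrame T n) : ∀ {q r m : ℕ} (h : r + q = m)
    (_ : m ≤ n) {η : Alt E r} (_ : IsSemibasic T η)
    (_ : ∀ ε : Alt E q, IsSemibasic T ε → wd h η ε = 0), η = 0
  | 0, r, m, h, _, η, _, h0 => by
    subst h
    have h1 := h0 (ContinuousAlternatingMap.constOfIsEmpty ℝ E (Fin 0) 1)
      (isSemibasic_of_degree_zero _)
    rw [wd_degree_zero] at h1
    simpa using h1
  | q + 1, r, m, h, hm, η, hη, h0 => by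
    subst h
    -- A covector is moved from the test form to `η`: `(l ∧ η) ∧ ε = ± η ∧ (l ∧ ε)`, so the
    -- induction lowers `q` while raising the degree of `η`.
    refine Φ.eq_zero_of_covecWedge (by omega) hη fun l hl => ?_
    refine Φ.eq_zero_of_wd (q := q) (m := r + q + 1) (by omega) hm (hl.covecWedge hη)
      fun ε hε => ?_
    have h1 := h0 (covecWedge l ε) (hl.covecWedge hε)
    rw [wd_covecWedge rfl] at h1
    rw [covecWedge_wd rfl]
    exact (smul_eq_zero.1 h1).resolve_left (pow_ne_zero _ (by norm_num))

/-- A subspace containing `(η ∧ ε₂) ∧ ε₁` for all semi-basic `ε₁` and `ε₂` contains `η ∧ ε` for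
all semi-basic `ε`. -/
theorem HorizontalFrame.wd_mem_of_wd_wd_mem (Φ : HorizontalFrame T n) {p : ℕ} :
    ∀ {q r m s e : ℕ} (h1 : r + q = m)
    (h2 : m + p = s) (h3 : r + e = s) (N : Submodule ℝ (Alt E s)) {η : Alt E r}
    (_ : ∀ ε₁ : Alt E p, IsSemibasic T ε₁ → ∀ ε₂ : Alt E q, IsSemibasic T ε₂ →
      wd h2 (wd h1 η ε₂) ε₁ ∈ N) {ε : Alt E e} (_ : IsSemibasic T ε), wd h3 η ε ∈ N
  | 0, r, m, s, e, h1, h2, h3, N, η, h, ε, hε => by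
    subst h1
    obtain rfl : e = p := by omega
    have := h ε hε (ContinuousAlternatingMap.constOfIsEmpty ℝ E (Fin 0) 1)
      (isSemibasic_of_degree_zero _)
    rw [wd_degree_zero] at this
    simpa using this
  | q + 1, r, m, s, e, h1, h2, h3, N, η, h, ε, hε => by
    obtain ⟨e', rfl⟩ : ∃ e', e = e' + 1 := ⟨q + p, by omega⟩
    subst h1
    subst h3
    refine Φ.semibasic_induction (P := fun ε => wd _ η ε ∈ N) (by simp)
      (fun x y hx hy => by rw [wd_add]; exact N.add_mem hx hy)
      (fun r x hx => by rw [wd_smul]; exact N.smul_mem _ hx) ?_ hε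
    intro l hl ε' hε'
    -- The covector `l` is absorbed into `η`, and the induction hypothesis is applied to `l ∧ η`,
    -- leaving a factor of degree `q`.
    rw [wd_covecWedge rfl, ← covecWedge_wd rfl (by omega)]
    refine N.smul_mem _ ?_
    refine Φ.wd_mem_of_wd_wd_mem (q := q) (m := r + q + 1) (by omega) h2 _ N ?_ hε'
    intro ε₁ hε₁ ε₂ hε₂
    have h4 := h ε₁ hε₁ (covecWedge l ε₂) (hl.covecWedge hε₂)
    rw [wd_covecWedge rfl, ← covecWedge_wd rfl (by omega), smul_wd] at h4
    have h5 := N.smul_mem ((-1 : ℝ) ^ r) h4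
    rwa [smul_smul, ← mul_pow, neg_one_mul, neg_neg, one_pow, one_smul] at h5

end Semibasic

/-! ### Contraction of forms with multivectors and of multivectors with forms. -/

section Interior

variable {E : Type*} [NormedAddCommGroup E] [NormedSpace ℝ E]

theorem castDeg_rfl {a : ℕ} (α : Alt E a) : castDeg rfl α = α := rfl

/-- The vector `u`, as a `1`-vector. -/
def vecMV (u : E) : MVec E 1 where
  toFun σ := σ (fun _ => u)
  map_add' _ _ := rfl
  map_smul' _ _ := rfl

@[simp] theorem vecMV_apply (u : E) (σ : Alt E 1) : vecMV u σ = σ (fun _ => u) := rfl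

theorem curryLeft_slice {p c N : ℕ} (h : N = p + c) (h' : N + 1 = p + 1 + c) (α : Alt E (N + 1))
    (w : Fin c → E) (u : E) :
    (slice (castDeg h' α) w).curryLeft u = slice (castDeg h (α.curryLeft u)) w := by
  subst h
  refine ContinuousAlternatingMap.ext fun v => ?_
  rw [ContinuousAlternatingMap.curryLeft_apply_apply, slice_apply, slice_apply, castDeg_rfl,
    ContinuousAlternatingMap.curryLeft_apply_apply, castDeg_apply]
  congr 1
  have := Fin.append_cons u v w
  rw [show Matrix.vecCons u v = Fin.cons u v from rfl, this]
  rfl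

/-- The vector `u` stands behind the `p` slots reserved for the multivector; bringing it to the
front costs `(-1)^p`. -/
theorem slice_cons {p c N : ℕ} (h : N = p + c) (h' : N + 1 = p + (c + 1)) (α : Alt E (N + 1))
    (w : Fin c → E) (u : E) :
    slice (castDeg h' α) (Matrix.vecCons u w)
      = (-1 : ℝ) ^ p • slice (castDeg h (α.curryLeft u)) w := by
  subst h
  refine ContinuousAlternatingMap.ext fun v => ?_
  rw [slice_apply, ContinuousAlternatingMap.smul_apply, slice_apply, castDeg_rfl, castDeg_rfl,
    ContinuousAlternatingMap.curryLeft_apply_apply]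
  have h2 := AlternatingMap.map_insertNth α.toAlternatingMap (⟨p, by omega⟩ : Fin (p + c + 1)) u
    (Fin.append v w)
  change α (Fin.insertNth _ u (Fin.append v w))
    = (-1) ^ p • α (Matrix.vecCons u (Fin.append v w)) at h2
  have h3 : (Fin.append v (Matrix.vecCons u w) : Fin (p + (c + 1)) → E)
      = Fin.insertNth (α := fun _ => E) (⟨p, by omega⟩ : Fin (p + c + 1)) u (Fin.append v w) := by
    refine (Fin.insertNth_eq_iff.2 ⟨?_, ?_⟩).symm
    · have := Fin.append_right v (Matrix.vecCons u w) 0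
      exact this.symm
    · funext j
      refine Fin.addCases (fun k => ?_) (fun k => ?_) j
      · have e : (⟨p, by omega⟩ : Fin (p + c + 1)).succAbove (Fin.castAdd c k)
            = Fin.castAdd (c + 1) k := by
          rw [Fin.succAbove_of_castSucc_lt]
          · rfl
          · simp [Fin.lt_def]
        rw [Fin.append_left, Fin.removeNth, e]
        exact (Fin.append_left v (Matrix.vecCons u w) k).symm
      · have e : (⟨p, by omega⟩ : Fin (p + c + 1)).succAbove (Fin.natAdd p k)
            = Fin.natAdd p k.succ := by
          rw [Fin.succAbove_of_le_castSucc]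
          · ext; simp; omega
          · simp [Fin.le_def]
        rw [Fin.append_right, Fin.removeNth, e]
        have := Fin.append_right v (Matrix.vecCons u w) k.succ
        exact this.symm
  rw [h3, h2]
  simp

theorem castDeg_vertDegreeLeOne {F : Type*} [NormedAddCommGroup F] [NormedSpace ℝ F]
    {T : E →L[ℝ] F} {a b : ℕ} (h : a = b) {α : Alt E a} (hα : VertDegreeLeOne T α) :
    VertDegreeLeOne T (castDeg h α) := by
  subst h; exact hα

theorem VertDegreeLeOne.slice {F : Type*} [NormedAddCommGroup F] [NormedSpace ℝ F]
    {T : E →L[ℝ] F} {p c : ℕ} {α : Alt E (p + c)} (hα : VertDegreeLeOne T α) (w : Fin c → E) :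
    VertDegreeLeOne T (slice α w) := by
  intro v i j hij hi hj
  refine hα _ (Fin.castAdd c i) (Fin.castAdd c j) (fun e => hij (Fin.castAdd_injective _ _ e)) ?_ ?_
  · simpa using hi
  · simpa using hj

theorem VertDegreeLeOne.slice_semibasic {F : Type*} [NormedAddCommGroup F] [NormedSpace ℝ F]
    {T : E →L[ℝ] F} {p c : ℕ} {α : Alt E (p + c)} (hα : VertDegreeLeOne T α) {w : Fin c → E}
    {i : Fin c} (hw : T (w i) = 0) : IsSemibasic T (GDirac.slice α w) := by
  rintro v ⟨j, hj⟩
  refine hα _ (Fin.castAdd c j) (Fin.natAdd p i) ?_ (by simpa using hj) (by simpa using hw)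
  intro e
  have := congrArg Fin.val e
  simp only [Fin.val_natAdd, Fin.val_castAdd] at this
  omega

/-- Contraction of a multivector with a covector. -/
def contractCovec {p : ℕ} (l : E →L[ℝ] ℝ) (V : MVec E (p + 1)) : MVec E p :=
  V.comp (covecWedgeL p l)

@[simp] theorem contractCovec_apply {p : ℕ} (l : E →L[ℝ] ℝ) (V : MVec E (p + 1)) (η : Alt E p) :
    contractCovec l V η = V (covecWedge l η) := rfl

variable [FiniteDimensional ℝ E]

/-- Reflexivity of a finite-dimensional space, since `1`-vectors are realised as functionals on
covectors. -/
theorem exists_vecMV (U : MVec E 1) : ∃ u : E, U = vecMV u := by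
  let e : Module.Dual ℝ E →ₗ[ℝ] Alt E 1 :=
    { toFun := fun l =>
        ContinuousAlternatingMap.ofSubsingleton ℝ E ℝ (0 : Fin 1) l.toContinuousLinearMap
      map_add' := fun l m => by
        refine ContinuousAlternatingMap.ext fun v => ?_
        simp
      map_smul' := fun r l => by
        refine ContinuousAlternatingMap.ext fun v => ?_
        simp }
  obtain ⟨u, hu⟩ := (Module.evalEquiv ℝ E).surjective (U.comp e)
  refine ⟨u, LinearMap.ext fun σ => ?_⟩
  have h1 : e ((ContinuousAlternatingMap.ofSubsingleton ℝ E ℝ (0 : Fin 1)).symm σ).toLinearMap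
      = σ := by
    refine ContinuousAlternatingMap.ext fun v => ?_
    change σ _ = σ v
    congr 1
    funext i
    rw [Subsingleton.elim i 0]
  have h2 := congrArg (fun f => f
    ((ContinuousAlternatingMap.ofSubsingleton ℝ E ℝ (0 : Fin 1)).symm σ).toLinearMap) hu
  simp only [LinearMap.comp_apply, h1] at h2
  rw [← h2]
  rfl

theorem interior_smul {p c a : ℕ} (h : p + c = a) (U : MVec E p) (r : ℝ) (α : Alt E a) :
    interior h U (r • α) = r • interior h U α := by
  subst h
  refine ContinuousAlternatingMap.ext fun w => ?_
  exact map_smul U r (slice α w)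

theorem add_interior {p c a : ℕ} (h : p + c = a) (U V : MVec E p) (α : Alt E a) :
    interior h (U + V) α = interior h U α + interior h V α := rfl

theorem smul_interior {p c a : ℕ} (h : p + c = a) (r : ℝ) (U : MVec E p) (α : Alt E a) :
    interior h (r • U) α = r • interior h U α := rfl

theorem interior_vecMV {c N : ℕ} (h : 1 + c = N + 1) (h' : N = c) (u : E) (α : Alt E (N + 1)) :
    interior h (vecMV u) α = castDeg h' (α.curryLeft u) := by
  subst h'
  refine ContinuousAlternatingMap.ext fun w => ?_
  rw [interior_apply, vecMV_apply, slice_apply, castDeg_rfl,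
    ContinuousAlternatingMap.curryLeft_apply_apply, castDeg_apply]
  congr 1
  rw [Fin.append_left_eq_cons]
  rfl

theorem curryLeft_interior {p c N : ℕ} (h : p + (c + 1) = N + 1) (h' : p + c = N) (U : MVec E p)
    (α : Alt E (N + 1)) (u : E) :
    (interior h U α).curryLeft u = (-1 : ℝ) ^ p • interior h' U (α.curryLeft u) := by
  refine ContinuousAlternatingMap.ext fun w => ?_
  rw [ContinuousAlternatingMap.curryLeft_apply_apply, interior_apply, slice_cons h'.symm, map_smul]
  rfl

theorem contractForm_apply {b p k : ℕ} (h : b + p = k) (ε : Alt E b) (U : MVec E k) (η : Alt E p) :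
    contractForm h ε U η = U (wd h ε η) := rfl

/-- Dual to associativity. It trades a covector factor of `ε` for a multivector of lower order,
which drives the induction in `exists_wd_interior`. -/
theorem contractForm_covecWedge {b p k : ℕ} (h : b + p = k) (h' : b + 1 + p = k + 1)
    (l : E →L[ℝ] ℝ) (ε : Alt E b) (V : MVec E (k + 1)) :
    contractForm h' (covecWedge l ε) V = contractForm h ε (contractCovec l V) := by
  refine LinearMap.ext fun η => ?_
  rw [contractForm_apply, contractForm_apply, contractCovec_apply, covecWedge_wd h]

theorem contractForm_add {b p k : ℕ} (h : b + p = k) (ε ε' : Alt E b) (U : MVec E k) :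
    contractForm h (ε + ε') U = contractForm h ε U + contractForm h ε' U := by
  refine LinearMap.ext fun η => ?_
  simp only [LinearMap.add_apply, contractForm_apply, add_wd, map_add]

theorem contractForm_smul {b p k : ℕ} (h : b + p = k) (r : ℝ) (ε : Alt E b) (U : MVec E k) :
    contractForm h (r • ε) U = r • contractForm h ε U := by
  refine LinearMap.ext fun η => ?_
  simp only [LinearMap.smul_apply, contractForm_apply, smul_wd, map_smul]

theorem contractForm_zero {b p k : ℕ} (h : b + p = k) (U : MVec E k) :
    contractForm h (0 : Alt E b) U = 0 := by
  refine LinearMap.ext fun η => ?_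
  simp [contractForm_apply]

theorem zero_interior {p c a : ℕ} (h : p + c = a) (α : Alt E a) :
    interior h (0 : MVec E p) α = 0 := rfl

theorem contractForm_degree_zero {k : ℕ} (ε : Alt E 0) (U : MVec E k) :
    contractForm (Nat.zero_add k) ε U = ε Fin.elim0 • U := by
  refine LinearMap.ext fun η => ?_
  rw [contractForm_apply, degree_zero_wd, map_smul]
  rfl

end Interior

/-! ### The algebraic core: recovering `ι_V α ∧ ε` from `ι_{ι_ε V} α`. -/

section Key

variable {E : Type*} [NormedAddCommGroup E] [NormedSpace ℝ E] [FiniteDimensional ℝ E]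
  {F : Type*} [NormedAddCommGroup F] [NormedSpace ℝ F] {T : E →L[ℝ] F}

theorem alt_induction {a : ℕ} {P : Alt E (a + 1) → Prop} (h0 : P 0)
    (hadd : ∀ x y, P x → P y → P (x + y)) (hsmul : ∀ (r : ℝ) x, P x → P (r • x))
    (hw : ∀ l (η : Alt E a), P (covecWedge l η)) (η : Alt E (a + 1)) : P η := by
  -- For the identity map only the zero vector is vertical, so every form is semi-basic.
  obtain ⟨Φ⟩ := exists_horizontalFrame (T := ContinuousLinearMap.id ℝ E) rfl
    Function.surjective_id
  refine Φ.semibasic_induction h0 hadd hsmul (fun l _ η _ => hw l η) ?_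
  rintro v ⟨i, hi⟩
  exact η.map_coord_zero i hi

/-- A vertical vector contracts only with the first factor of `α ∧ ε`, `ε` semi-basic. -/
theorem curryLeft_wd {u : E} (hu : T u = 0) {b : ℕ} {ε : Alt E b} (hε : IsSemibasic T ε) :
    ∀ {a c : ℕ} (h : a + b = c) (h' : a + 1 + b = c + 1) (α : Alt E (a + 1)),
      (wd h' α ε).curryLeft u = wd h (α.curryLeft u) ε := by
  intro a
  induction a with
  | zero =>
    intro c h h' α
    obtain rfl : b = c := by omega
    refine alt_induction (P := fun α => (wd h' α ε).curryLeft u = wd h (α.curryLeft u) ε)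
      (by simp) (fun x y hx hy => by
        simp only [add_wd, ContinuousAlternatingMap.curryLeft_add, add_apply, hx, hy])
      (fun r x hx => by
        simp only [smul_wd, ContinuousAlternatingMap.curryLeft_smul, smul_apply, hx]) ?_ α
    intro l α
    rw [covecWedge_wd h, degree_zero_wd, covecWedge_smul, curryLeft_covecWedge_zero, smul_wd,
      degree_zero_wd, ContinuousAlternatingMap.curryLeft_smul, smul_apply]
    cases b with
    | zero => rw [curryLeft_covecWedge_zero, smul_comm]
    | succ b =>
      rw [curryLeft_covecWedge, isSemibasic_iff_curryLeft.1 hε u hu, covecWedge_zero, sub_zero,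
        smul_comm]
  | succ a ih =>
    intro c h h' α
    obtain ⟨c, rfl⟩ : ∃ c', c = c' + 1 := ⟨a + b, by omega⟩
    refine alt_induction (P := fun α => (wd h' α ε).curryLeft u = wd h (α.curryLeft u) ε)
      (by simp) (fun x y hx hy => by
        simp only [add_wd, ContinuousAlternatingMap.curryLeft_add, add_apply, hx, hy])
      (fun r x hx => by
        simp only [smul_wd, ContinuousAlternatingMap.curryLeft_smul, smul_apply, hx]) ?_ α
    intro l α
    rw [covecWedge_wd h, curryLeft_covecWedge, curryLeft_covecWedge, ih (by omega), sub_eq_add_neg,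
      sub_eq_add_neg, add_wd, smul_wd, ← neg_one_smul ℝ (covecWedge l (α.curryLeft u)), smul_wd,
      covecWedge_wd (by omega)]
    exact congrArg _ (neg_one_smul ℝ _).symm

/-- Once a vertical vector fills one slot of `α`, what remains in the slots of `V` is semi-basic and
is killed by `V`. -/
theorem VertDegreeLeOne.interior_semibasic {p c a : ℕ} (h : p + c = a) {V : MVec E p}
    (hV : ∀ σ : Alt E p, IsSemibasic T σ → V σ = 0) {α : Alt E a} (hα : VertDegreeLeOne T α) :
    IsSemibasic T (interior h V α) := by
  rintro w ⟨i, hi⟩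
  rw [interior_apply]
  exact hV _ ((castDeg_vertDegreeLeOne h.symm hα).slice_semibasic hi)

variable {n : ℕ}

/-- A multivector which annihilates the semi-basic forms has one vertical factor, when applied to
forms of vertical degree at most one. -/
theorem HorizontalFrame.apply_eq_sum (Φ : HorizontalFrame T n) {q : ℕ} {V : MVec E (q + 2)}
    (hV : ∀ σ : Alt E (q + 2), IsSemibasic T σ → V σ = 0) {σ : Alt E (q + 2)}
    (hσ : VertDegreeLeOne T σ) :
    ∑ j, V (covecWedge (Φ.φ j) (σ.curryLeft (Φ.f j))) = ((q : ℝ) + 1) * V σ := by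
  -- The sum counts horizontal slots. Contracting with a vertical `v` leaves a semi-basic form of
  -- degree `q + 1`, on which the count is exactly `q + 1`; hence the difference is semi-basic and
  -- `V` does not see it.
  have h1 : IsSemibasic T (∑ j, covecWedge (Φ.φ j) (σ.curryLeft (Φ.f j))
      - ((q : ℝ) + 1) • σ : Alt E (q + 2)) := by
    refine isSemibasic_iff_curryLeft.2 fun v hv => ?_
    have h2 := Φ.euler (hσ.curryLeft hv)
    have h3 : (∑ j, covecWedge (Φ.φ j) (σ.curryLeft (Φ.f j)) : Alt E (q + 2)).curryLeft v
        = ∑ j, covecWedge (Φ.φ j) ((σ.curryLeft v).curryLeft (Φ.f j)) := by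
      let L : Alt E (q + 2) →ₗ[ℝ] Alt E (q + 1) :=
        { toFun := fun τ => τ.curryLeft v
          map_add' := fun _ _ => rfl
          map_smul' := fun _ _ => rfl }
      refine (map_sum L _ _).trans (Finset.sum_congr rfl fun j _ => ?_)
      change (covecWedge (Φ.φ j) (σ.curryLeft (Φ.f j))).curryLeft v = _
      rw [curryLeft_covecWedge, Φ.semibasic j v hv, zero_smul, zero_sub,
        curryLeft_add_neg_comm, covecWedge_neg, neg_neg]
    rw [sub_eq_add_neg, ContinuousAlternatingMap.curryLeft_add, add_apply, h3, h2,
      ← neg_one_smul ℝ (((q : ℝ) + 1) • σ), ContinuousAlternatingMap.curryLeft_smul,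
      ContinuousAlternatingMap.curryLeft_smul]
    simp
  have h2 := hV _ h1
  rw [map_sub, map_sum, map_smul, sub_eq_zero] at h2
  exact h2

/-- The count of `apply_eq_sum` is applied to each slice of `α`; taking `f j` out of the contraction
with a `(q + 1)`-vector gives the sign. Thus `ι_V α` is recovered as a trace of `l ↦ ι_{ι_l V} α`.
-/
theorem HorizontalFrame.interior_eq_sum (Φ : HorizontalFrame T n) {q c N : ℕ}
    (h : q + 2 + c = N + 1) (h' : q + 1 + (c + 1) = N + 1) {V : MVec E (q + 2)}
    (hV : ∀ σ : Alt E (q + 2), IsSemibasic T σ → V σ = 0) {α : Alt E (N + 1)}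
    (hα : VertDegreeLeOne T α) :
    ((q : ℝ) + 1) • interior h V α = (-1 : ℝ) ^ (q + 1) •
      ∑ j, (interior h' (contractCovec (Φ.φ j) V) α).curryLeft (Φ.f j) := by
  refine ContinuousAlternatingMap.ext fun w => ?_
  rw [ContinuousAlternatingMap.smul_apply, interior_apply, smul_eq_mul,
    ← Φ.apply_eq_sum hV ((castDeg_vertDegreeLeOne h.symm hα).slice w),
    ContinuousAlternatingMap.smul_apply, ContinuousAlternatingMap.sum_apply, Finset.smul_sum]
  refine Finset.sum_congr rfl fun j _ => ?_
  rw [curryLeft_interior h' (by omega : q + 1 + c = N), ContinuousAlternatingMap.smul_apply,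
    smul_smul, ← mul_pow, neg_one_mul, neg_neg, one_pow, one_smul, interior_apply,
    contractCovec_apply, curryLeft_slice (p := q + 1) (by omega : N = q + 1 + c)]

/-- If the covector-valued contractions `X l = ι_{ι_l V} α` satisfy `l ∧ X l = 0`, then `l ∧ ι_V α`
is proportional to `X l`. -/
theorem HorizontalFrame.covecWedge_interior (Φ : HorizontalFrame T n) {q c N : ℕ}
    (h : q + 2 + c = N + 1) (h' : q + 1 + (c + 1) = N + 1) {V : MVec E (q + 2)}
    (hV : ∀ σ : Alt E (q + 2), IsSemibasic T σ → V σ = 0) {α : Alt E (N + 1)}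
    (hα : VertDegreeLeOne T α)
    (hX : ∀ l, IsSemibasicCovec T l → covecWedge l (interior h' (contractCovec l V) α) = 0)
    {l : E →L[ℝ] ℝ} (hl : IsSemibasicCovec T l) :
    ((q : ℝ) + 1) • covecWedge l (interior h V α)
      = ((-1 : ℝ) ^ (q + 1) * ((n : ℝ) - c)) • interior h' (contractCovec l V) α := by
  set X : (E →L[ℝ] ℝ) → Alt E (c + 1) := fun l => interior h' (contractCovec l V) α with hXdef
  have hadd : ∀ l m, X (l + m) = X l + X m := by
    intro l m
    simp only [hXdef]
    rw [← add_interior]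
    congr 1
    refine LinearMap.ext fun η => ?_
    simp [add_covecWedge]
  have hsmul : ∀ (r : ℝ) l, X (r • l) = r • X l := by
    intro r l
    simp only [hXdef]
    rw [← smul_interior]
    congr 1
    refine LinearMap.ext fun η => ?_
    simp [smul_covecWedge]
  -- Polarisation of the quadratic identity `l ∧ X l = 0`.
  have hpol : ∀ l m, IsSemibasicCovec T l → IsSemibasicCovec T m →
      covecWedge l (X m) = -covecWedge m (X l) := by
    intro l m hl hm
    have h1 := hX (l + m) (fun v hv => by rw [add_apply, hl v hv, hm v hv, add_zero])
    change covecWedge (l + m) (X (l + m)) = 0 at h1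
    rw [hadd, add_covecWedge, covecWedge_add, covecWedge_add, hX l hl, hX m hm, zero_add,
      add_zero] at h1
    exact eq_neg_of_add_eq_zero_left h1
  have hsb : ∀ l, IsSemibasicCovec T l → IsSemibasic T (X l) := fun l hl =>
    hα.interior_semibasic h' fun σ hσ => hV _ (hl.covecWedge hσ)
  rw [← covecWedge_smul, Φ.interior_eq_sum h h' hV hα, covecWedge_smul, mul_smul, covecWedge_sum]
  congr 1
  change ∑ j, covecWedge l ((X (Φ.φ j)).curryLeft (Φ.f j)) = ((n : ℝ) - c) • X l
  -- The polarised identity for `l` and `φ j`, contracted with `f j`. Summing over `j`, the three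
  -- terms contribute `1`, `n` and `-(c + 1)` times `X l`, in total `n - c`.
  have h1 : ∀ j, covecWedge l ((X (Φ.φ j)).curryLeft (Φ.f j))
      = l (Φ.f j) • X (Φ.φ j) + X l - covecWedge (Φ.φ j) ((X l).curryLeft (Φ.f j)) := by
    intro j
    have h2 := curryLeft_covecWedge l (X (Φ.φ j)) (Φ.f j)
    rw [hpol l _ hl (Φ.semibasic j), ← neg_one_smul ℝ (covecWedge (Φ.φ j) (X l)),
      ContinuousAlternatingMap.curryLeft_smul, smul_apply, curryLeft_covecWedge, Φ.dual_self,
      one_smul] at h2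
    rw [← sub_eq_zero] at h2 ⊢
    rw [← h2]
    module
  simp only [h1, Finset.sum_sub_distrib, Finset.sum_add_distrib, Φ.euler (hsb l hl)]
  have h3 : ∑ j, l (Φ.f j) • X (Φ.φ j) = X l := by
    conv_rhs => rw [Φ.covec_eq hl]
    rw [← Finset.sum_hom_rel (r := fun (x : E →L[ℝ] ℝ) y => X x = y) (f := fun j => l (Φ.f j) • Φ.φ j)
      (g := fun j => l (Φ.f j) • X (Φ.φ j)) (s := Finset.univ)]
    · simpa using hsmul 0 0
    · intro j x y hxy
      rw [hadd, hsmul, hxy]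
  rw [h3, Finset.sum_const, Finset.card_univ, Fintype.card_fin, ← Nat.cast_smul_eq_nsmul ℝ]
  module

/-- If `l ∧ ι_{ι_ε V} α = 0` whenever `l ∧ ε = 0`, then `ι_V α ∧ ε` is a universal multiple of
`ι_{ι_ε V} α`. -/
theorem exists_wd_interior (E F : Type*) [NormedAddCommGroup E] [NormedSpace ℝ E]
    [FiniteDimensional ℝ E] [NormedAddCommGroup F] [NormedSpace ℝ F] (n : ℕ) :
    ∀ (q c : ℕ), q + 1 + c ≤ n → ∃ κ : ℝ, κ ≠ 0 ∧
    ∀ (T : E →L[ℝ] F) (_ : HorizontalFrame T n) (N m : ℕ) (hN : q + 1 + c = N) (hm : 1 + m = N)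
      (hq : c + q = m) (V : MVec E (q + 1)) (α : Alt E N),
      (∀ σ : Alt E (q + 1), IsSemibasic T σ → V σ = 0) → VertDegreeLeOne T α →
      (∀ l, IsSemibasicCovec T l → ∀ ε : Alt E q, IsSemibasic T ε → covecWedge l ε = 0 →
        covecWedge l (interior hm (contractForm rfl ε V) α) = 0) →
      ∀ ε : Alt E q, IsSemibasic T ε →
        wd hq (interior hN V α) ε = κ • interior hm (contractForm rfl ε V) α := by
  intro q
  induction q with
  | zero =>
    intro c _
    refine ⟨1, one_ne_zero, ?_⟩
    intro T _ N m hN hm hq V α _ _ _ ε _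
    obtain rfl : c = m := hq
    rw [wd_degree_zero, contractForm_degree_zero, one_smul, smul_interior]
  | succ q ih =>
    intro c hc
    obtain ⟨κ, hκ, h⟩ := ih (c + 1) (by omega)
    have hnc : ((n : ℝ) - c) ≠ 0 := by
      have : (c : ℝ) < n := by exact_mod_cast (by omega : c < n)
      linarith
    have hq1 : ((q : ℝ) + 1) ≠ 0 := by positivity
    -- The factor `(-1)^c` moves `l` past `ι_V α`, the middle factor is the constant of
    -- `covecWedge_interior`, and `κ` is the constant for `ι_l V`. It is fixed before `T`, `V` and
    -- `α`, so that one value will serve at all points of `M`.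
    refine ⟨(-1) ^ c * ((((q : ℝ) + 1)⁻¹ * ((-1 : ℝ) ^ (q + 1) * ((n : ℝ) - c))) * κ), ?_, ?_⟩
    · have : ∀ k : ℕ, (-1 : ℝ) ^ k ≠ 0 := fun k => pow_ne_zero _ (by norm_num)
      exact mul_ne_zero (this _) (mul_ne_zero (mul_ne_zero (inv_ne_zero hq1)
        (mul_ne_zero (this _) hnc)) hκ)
    intro T Φ N m hN hm hq V α hV hα H ε hε
    obtain ⟨N, rfl⟩ : ∃ N', N = N' + 1 := ⟨m, by omega⟩
    subst hq
    -- The induction hypothesis for `ι_l V`. It inherits the condition on `ε`, because `l' ∧ ε' = 0`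
    -- implies `l' ∧ (l ∧ ε') = 0`.
    have ihl : ∀ l, IsSemibasicCovec T l → ∀ ε : Alt E q, IsSemibasic T ε →
        wd (by omega : c + 1 + q = c + (q + 1))
          (interior (by omega : q + 1 + (c + 1) = N + 1) (contractCovec l V) α) ε
          = κ • interior hm (contractForm (p := 1) rfl (covecWedge l ε) V) α := by
      intro l hl ε hε
      rw [contractForm_covecWedge (p := 1) (k := q + 1) rfl]
      refine h T Φ (N + 1) (c + (q + 1)) _ hm _ (contractCovec l V) α
        (fun σ hσ => hV _ (hl.covecWedge hσ)) hα ?_ ε hε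
      intro l' hl' ε' hε' h0
      rw [← contractForm_covecWedge (p := 1) (k := q + 1) rfl (by omega)]
      refine H l' hl' _ (hl.covecWedge hε') ?_
      rw [covecWedge_anticomm, h0, covecWedge_zero, neg_zero]
    -- By the perfect pairing it suffices to wedge with every `ε`; then `ihl` turns the expression
    -- into `l ∧ ι_{ι_{l ∧ ε} V} α`, which vanishes because `l ∧ (l ∧ ε) = 0`.
    have hX : ∀ l, IsSemibasicCovec T l → covecWedge l
        (interior (by omega : q + 1 + (c + 1) = N + 1) (contractCovec l V) α) = 0 := by
      intro l hl
      refine Φ.eq_zero_of_wd (q := q) (m := c + 1 + 1 + q) rfl (by omega) (hl.covecWedge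
        (hα.interior_semibasic (V := contractCovec l V) _ fun σ hσ => hV _ (hl.covecWedge hσ))) fun ε hε => ?_
      have e : c + 1 + 1 + q = c + (q + 1) + 1 := by omega
      have h2 : wd e (covecWedge l
        (interior (by omega : q + 1 + (c + 1) = N + 1) (contractCovec l V) α)) ε = 0 := by
        rw [covecWedge_wd (by omega : c + 1 + q = c + (q + 1)), ihl l hl ε hε, covecWedge_smul,
          H l hl _ (hl.covecWedge hε) (covecWedge_self l ε), smul_zero]
      revert h2
      generalize c + (q + 1) + 1 = M at e
      subst e
      exact id
    refine Φ.semibasic_induction (P := fun ε => wd rfl (interior hN V α) ε = _ • interior hm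
      (contractForm (p := 1) rfl ε V) α) ?_ ?_ ?_ ?_ hε
    · rw [wd_zero, contractForm_zero, zero_interior, smul_zero]
    · intro x y hx hy
      rw [wd_add, contractForm_add, add_interior, hx, hy, smul_add]
    · intro r x hx
      rw [wd_smul, contractForm_smul, smul_interior, hx, smul_comm]
    · intro l hl ε' hε'
      have h3 := Φ.covecWedge_interior hN (by omega) hV hα hX hl
      rw [wd_covecWedge rfl rfl, ← covecWedge_wd rfl (by omega : c + 1 + q = c + (q + 1)),
        ← inv_smul_smul₀ hq1 (covecWedge l (interior hN V α)), h3, smul_smul, smul_wd,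
        ihl l hl ε' hε', smul_smul, smul_smul, mul_assoc]

end Key

/-! ### Smoothness and exterior derivatives of form-valued functions on a vector space. -/

section Calculus

variable {E : Type*} [NormedAddCommGroup E] [NormedSpace ℝ E] [FiniteDimensional ℝ E]
  {G : Type*} [NormedAddCommGroup G] [NormedSpace ℝ G]

theorem minSmoothness_two_le : minSmoothness ℝ 2 ≤ (∞ : WithTop ℕ∞) := by
  rw [minSmoothness_of_isRCLikeNormedField]
  exact WithTop.coe_le_coe.2 (le_top : (2 : ℕ∞) ≤ ⊤)

/-- A form depends linearly on its finitely many values on tuples of basis vectors. -/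
theorem contDiffWithinAt_of_eval {a : ℕ} {k : WithTop ℕ∞} {f : G → Alt E a} {s : Set G} {x : G}
    (h : ∀ v, ContDiffWithinAt ℝ k (fun y => f y v) s x) : ContDiffWithinAt ℝ k f s x := by
  let b := Module.finBasis ℝ E
  let e : Alt E a →ₗ[ℝ] ((Fin a → Fin (Module.finrank ℝ E)) → ℝ) :=
    { toFun := fun α r => α (fun i => b (r i))
      map_add' := fun _ _ => rfl
      map_smul' := fun _ _ => rfl }
  have he : Function.Injective e := by
    intro α β hαβ
    have h1 : α.toMultilinearMap = β.toMultilinearMap :=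
      Module.Basis.ext_multilinear (fun _ => b) fun r => congrFun hαβ r
    refine ContinuousAlternatingMap.ext fun v => ?_
    exact congrArg (fun g : MultilinearMap ℝ (fun _ : Fin a => E) ℝ => g v) h1
  obtain ⟨g, hg⟩ := e.exists_leftInverse_of_injective (LinearMap.ker_eq_bot.2 he)
  have h2 : f = fun y => LinearMap.toContinuousLinearMap g (e (f y)) := by
    funext y
    exact (LinearMap.congr_fun hg (f y)).symm
  rw [h2]
  refine (LinearMap.toContinuousLinearMap g).contDiff.comp_contDiffWithinAt ?_
  exact contDiffWithinAt_pi.2 fun r => h _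

theorem contDiffWithinAt_alt_apply_const {a : ℕ} {k : WithTop ℕ∞} {f : G → Alt E a} {s : Set G}
    {x : G} (hf : ContDiffWithinAt ℝ k f s x) (v : Fin a → E) :
    ContDiffWithinAt ℝ k (fun y => f y v) s x :=
  (ContinuousAlternatingMap.apply ℝ E ℝ v).contDiff.comp_contDiffWithinAt hf

theorem contDiffWithinAt_alt_apply {a : ℕ} {k : WithTop ℕ∞} {f : G → Alt E a} {s : Set G} {x : G}
    (hf : ContDiffWithinAt ℝ k f s x) {v : Fin a → G → E}
    (hv : ∀ i, ContDiffWithinAt ℝ k (v i) s x) :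
    ContDiffWithinAt ℝ k (fun y => f y (fun i => v i y)) s x := by
  let b := Module.finBasis ℝ E
  have key : ∀ y, f y (fun i => v i y) = ∑ r : (Fin a → Fin (Module.finrank ℝ E)),
      (∏ i, b.repr (v i y) (r i)) * f y (fun i => b (r i)) := by
    intro y
    have h : (fun i => v i y) = fun i => ∑ j, b.repr (v i y) j • b j := by
      funext i; exact (b.sum_repr (v i y)).symm
    conv_lhs => rw [h]
    change (f y).toMultilinearMap _ = _
    rw [MultilinearMap.map_sum]
    refine Finset.sum_congr rfl fun r _ => ?_
    rw [MultilinearMap.map_smul_univ]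
    rfl
  rw [show (fun y => f y (fun i => v i y)) = _ from funext key]
  refine ContDiffWithinAt.sum fun r _ => ContDiffWithinAt.mul ?_ (contDiffWithinAt_alt_apply_const hf _)
  refine contDiffWithinAt_prod fun i _ => ?_
  exact (LinearMap.toContinuousLinearMap (b.coord (r i))).contDiff.comp_contDiffWithinAt (hv i)

theorem contDiffWithinAt_alt_comp {E' : Type*} [NormedAddCommGroup E'] [NormedSpace ℝ E']
    [FiniteDimensional ℝ E'] {a : ℕ} {k : WithTop ℕ∞} {f : G → Alt E a} {s : Set G} {x : G}
    (hf : ContDiffWithinAt ℝ k f s x) {L : G → E' →L[ℝ] E} (hL : ContDiffWithinAt ℝ k L s x) :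
    ContDiffWithinAt ℝ k (fun y => (f y).compContinuousLinearMap (L y)) s x :=
  contDiffWithinAt_of_eval fun _ =>
    contDiffWithinAt_alt_apply hf fun _ => hL.clm_apply contDiffWithinAt_const

theorem isBoundedBilinearMap_of_finiteDimensional {V W Z : Type*} [NormedAddCommGroup V]
    [NormedSpace ℝ V] [FiniteDimensional ℝ V] [NormedAddCommGroup W] [NormedSpace ℝ W]
    [FiniteDimensional ℝ W] [NormedAddCommGroup Z] [NormedSpace ℝ Z] (B : V → W → Z)
    (h1 : ∀ x y z, B (x + y) z = B x z + B y z) (h2 : ∀ (r : ℝ) y z, B (r • y) z = r • B y z)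
    (h3 : ∀ x y z, B x (y + z) = B x y + B x z) (h4 : ∀ (r : ℝ) y z, B y (r • z) = r • B y z) :
    IsBoundedBilinearMap ℝ (fun p : V × W => B p.1 p.2) :=
  (LinearMap.toContinuousBilinearMap (LinearMap.mk₂ ℝ B h1 h2 h3 h4)).isBoundedBilinearMap

theorem contDiffWithinAt_bilinear {V W Z : Type*} [NormedAddCommGroup V]
    [NormedSpace ℝ V] [NormedAddCommGroup W] [NormedSpace ℝ W]
    [NormedAddCommGroup Z] [NormedSpace ℝ Z] {B : V → W → Z}
    (hB : IsBoundedBilinearMap ℝ (fun p : V × W => B p.1 p.2)) {k : WithTop ℕ∞} {f : G → V}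
    {g : G → W} {s : Set G} {x : G} (hf : ContDiffWithinAt ℝ k f s x)
    (hg : ContDiffWithinAt ℝ k g s x) : ContDiffWithinAt ℝ k (fun y => B (f y) (g y)) s x :=
  hB.contDiff.comp_contDiffWithinAt (hf.prodMk hg)

theorem fderiv_bilinear {V W Z : Type*} [NormedAddCommGroup V]
    [NormedSpace ℝ V] [NormedAddCommGroup W] [NormedSpace ℝ W]
    [NormedAddCommGroup Z] [NormedSpace ℝ Z] {B : V → W → Z}
    (hB : IsBoundedBilinearMap ℝ (fun p : V × W => B p.1 p.2)) {f : G → V}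
    {g : G → W} {x : G} (hf : DifferentiableAt ℝ f x) (hg : DifferentiableAt ℝ g x) (v : G) :
    fderiv ℝ (fun y => B (f y) (g y)) x v
      = B (f x) (fderiv ℝ g x v) + B (fderiv ℝ f x v) (g x) :=
  congrArg (fun L => L v) (HasFDerivAt.comp x (hB.hasFDerivAt (f x, g x))
    (hf.hasFDerivAt.prodMk hg.hasFDerivAt)).fderiv

theorem contDiffWithinAt_wd {a b c : ℕ} (h : a + b = c) {k : WithTop ℕ∞} {f : G → Alt E a}
    {g : G → Alt E b} {s : Set G} {x : G} (hf : ContDiffWithinAt ℝ k f s x)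
    (hg : ContDiffWithinAt ℝ k g s x) :
    ContDiffWithinAt ℝ k (fun y => wd h (f y) (g y)) s x :=
  contDiffWithinAt_bilinear (V := Alt E a) (W := Alt E b) (Z := Alt E c)
    (isBoundedBilinearMap_of_finiteDimensional (V := Alt E a) (W := Alt E b) (Z := Alt E c) (wd h)
    (fun α α' β => add_wd h α α' β) (fun r α β => smul_wd h r α β)
    (fun α β β' => wd_add h α β β') (fun r α β => wd_smul h r α β)) hf hg

theorem fderiv_wd {a b c : ℕ} (h : a + b = c) {f : G → Alt E a} {g : G → Alt E b} {x : G}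
    (hf : DifferentiableAt ℝ f x) (hg : DifferentiableAt ℝ g x) (v : G) :
    fderiv ℝ (fun y => wd h (f y) (g y)) x v
      = wd h (f x) (fderiv ℝ g x v) + wd h (fderiv ℝ f x v) (g x) :=
  fderiv_bilinear (V := Alt E a) (W := Alt E b) (Z := Alt E c)
    (isBoundedBilinearMap_of_finiteDimensional (V := Alt E a) (W := Alt E b) (Z := Alt E c) (wd h)
    (fun α α' β => add_wd h α α' β) (fun r α β => smul_wd h r α β)
    (fun α β β' => wd_add h α β β') (fun r α β => wd_smul h r α β)) hf hg v

/-- Yields `d = ∑ φ_j ∧ ∂_j`, so that the Leibniz rule follows from that of `fderiv` and the rules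
for moving a covector through a wedge product. -/
theorem exists_frame_alternatize (E : Type*) [NormedAddCommGroup E] [NormedSpace ℝ E]
    [FiniteDimensional ℝ E] : ∃ (m : ℕ) (φ : Fin m → E →L[ℝ] ℝ) (e : Fin m → E),
      ∀ (a : ℕ) (L : E →L[ℝ] Alt E a),
        ContinuousAlternatingMap.alternatizeUncurryFin L = ∑ j, covecWedge (φ j) (L (e j)) := by
  obtain ⟨Φ⟩ := exists_horizontalFrame (T := ContinuousLinearMap.id ℝ E) rfl
    Function.surjective_id
  refine ⟨_, Φ.φ, Φ.f, fun a L => ?_⟩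
  have h1 : L = ∑ j, (Φ.φ j).smulRight (L (Φ.f j)) := by
    refine ContinuousLinearMap.ext fun v => ?_
    have h2 : v = ∑ j, Φ.φ j v • Φ.f j := sub_eq_zero.1 (Φ.decomp v)
    conv_lhs => rw [h2]
    simp
  conv_lhs => rw [h1]
  rw [← ContinuousAlternatingMap.alternatizeUncurryFinCLM_apply, map_sum]
  rfl

theorem extDeriv_wd {a b c : ℕ} (h : a + b = c) {f : E → Alt E a} {g : E → Alt E b} {x : E}
    (hf : DifferentiableAt ℝ f x) (hg : DifferentiableAt ℝ g x) :
    extDeriv (fun y => wd h (f y) (g y)) x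
      = wd (by omega : a + 1 + b = c + 1) (extDeriv f x) (g x)
        + (-1 : ℝ) ^ a • wd (by omega : a + (b + 1) = c + 1) (f x) (extDeriv g x) := by
  obtain ⟨m, φ, e, hφ⟩ := exists_frame_alternatize E
  have hφ' : ∀ (a : ℕ) (f : E → Alt E a),
      extDeriv f x = ∑ j, covecWedge (φ j) (fderiv ℝ f x (e j)) := fun a f => hφ a _
  rw [hφ', hφ', hφ']
  simp only [fderiv_wd h hf hg, covecWedge_add, Finset.sum_add_distrib]
  refine (add_comm _ _).trans (congrArg₂ _ ?_ ?_)
  · rw [← wdL_apply, map_sum, LinearMap.sum_apply]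
    refine Finset.sum_congr rfl fun j _ => ?_
    rw [wdL_apply, covecWedge_wd h]
  · rw [wd_sum, Finset.smul_sum]
    refine Finset.sum_congr rfl fun j _ => ?_
    rw [wd_covecWedge h, smul_smul, ← mul_pow, neg_one_mul, neg_neg, one_pow, one_smul]

theorem contDiffOn_extDeriv {a : ℕ} {f : E → Alt E a} {s : Set E} (hs : IsOpen s)
    (hf : ContDiffOn ℝ ∞ f s) : ContDiffOn ℝ ∞ (extDeriv f) s := by
  have h1 : ContDiffOn ℝ ∞ (fderiv ℝ f) s := hf.fderiv_of_isOpen hs (by simp)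
  exact (ContinuousAlternatingMap.alternatizeUncurryFinCLM ℝ E ℝ).contDiff.comp_contDiffOn h1

end Calculus

/-! ### Chart independence of `d`, through pullbacks. -/

section Charts

variable {E : Type*} [NormedAddCommGroup E] [NormedSpace ℝ E] [FiniteDimensional ℝ E]
  {M : Type*} [TopologicalSpace M] [ChartedSpace E M] [IsManifold 𝓘(ℝ, E) ∞ M]

theorem chartSymmDeriv_comp_chartDeriv {x₀ z : M} (hz : z ∈ (extChartAt 𝓘(ℝ, E) x₀).source) :
    (chartSymmDeriv E x₀ (extChartAt 𝓘(ℝ, E) x₀ z)).comp (chartDeriv E x₀ z)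
      = ContinuousLinearMap.id ℝ E := by
  have h := mfderivWithin_extChartAt_symm_comp_mfderiv_extChartAt' (I := 𝓘(ℝ, E)) hz
  rw [modelWithCornersSelf_coe, Set.range_id, mfderivWithin_univ] at h
  exact h

theorem chartDeriv_comp_chartSymmDeriv {x₀ : M} {y : E}
    (hy : y ∈ (extChartAt 𝓘(ℝ, E) x₀).target) :
    (chartDeriv E x₀ ((extChartAt 𝓘(ℝ, E) x₀).symm y)).comp (chartSymmDeriv E x₀ y)
      = ContinuousLinearMap.id ℝ E := by
  have h := mfderiv_extChartAt_comp_mfderivWithin_extChartAt_symm (I := 𝓘(ℝ, E)) hy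
  rw [modelWithCornersSelf_coe, Set.range_id, mfderivWithin_univ] at h
  exact h

theorem alt_comp_comp {E₁ E₂ E₃ : Type*} [NormedAddCommGroup E₁] [NormedSpace ℝ E₁]
    [NormedAddCommGroup E₂] [NormedSpace ℝ E₂] [NormedAddCommGroup E₃] [NormedSpace ℝ E₃] {a : ℕ}
    (α : Alt E₃ a) (L : E₂ →L[ℝ] E₃) (K : E₁ →L[ℝ] E₂) :
    (α.compContinuousLinearMap L).compContinuousLinearMap K
      = α.compContinuousLinearMap (L.comp K) := rfl

theorem alt_comp_id {a : ℕ} (α : Alt E a) :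
    α.compContinuousLinearMap (ContinuousLinearMap.id ℝ E) = α := rfl

theorem formInChart_comp_chartDeriv {a : ℕ} (α : Form E M a) {x₀ z : M}
    (hz : z ∈ (extChartAt 𝓘(ℝ, E) x₀).source) :
    (formInChart x₀ α (extChartAt 𝓘(ℝ, E) x₀ z)).compContinuousLinearMap (chartDeriv E x₀ z)
      = α z := by
  rw [formInChart, alt_comp_comp, chartSymmDeriv_comp_chartDeriv hz,
    (extChartAt 𝓘(ℝ, E) x₀).left_inv hz]
  rfl

section Pullback

variable {G : Type*} [NormedAddCommGroup G] [NormedSpace ℝ G]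

/-- The pullback of a form by a map from a vector space. -/
def pullbackForm {a : ℕ} (g : G → M) (α : Form E M a) (y : G) : Alt G a :=
  (α (g y)).compContinuousLinearMap (mfderiv 𝓘(ℝ, G) 𝓘(ℝ, E) g y : G →L[ℝ] E)

theorem pullbackForm_eq {a : ℕ} {g : G → M} (α : Form E M a) {x₀ : M} {y : G}
    (hg : MDifferentiableAt 𝓘(ℝ, G) 𝓘(ℝ, E) g y)
    (hy : g y ∈ (extChartAt 𝓘(ℝ, E) x₀).source) :
    pullbackForm g α y = (formInChart x₀ α (extChartAt 𝓘(ℝ, E) x₀ (g y))).compContinuousLinearMap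
      (fderiv ℝ (fun z => extChartAt 𝓘(ℝ, E) x₀ (g z)) y) := by
  have h1 : fderiv ℝ (fun z => extChartAt 𝓘(ℝ, E) x₀ (g z)) y
      = (chartDeriv E x₀ (g y)).comp (mfderiv 𝓘(ℝ, G) 𝓘(ℝ, E) g y : G →L[ℝ] E) := by
    rw [← mfderiv_eq_fderiv]
    exact mfderiv_comp y (mdifferentiableAt_extChartAt (by rwa [extChartAt_source] at hy)) hg
  rw [pullbackForm, ← formInChart_comp_chartDeriv α hy]
  exact (congrArg (fun L => (formInChart x₀ α (extChartAt 𝓘(ℝ, E) x₀ (g y))).compContinuousLinearMap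
    L) h1).symm

theorem contDiffAt_chart_comp {g : G → M} {x₀ : M} {y : G}
    (hg : ContMDiffAt 𝓘(ℝ, G) 𝓘(ℝ, E) ∞ g y)
    (hy : g y ∈ (extChartAt 𝓘(ℝ, E) x₀).source) :
    ContDiffAt ℝ ∞ (fun z => extChartAt 𝓘(ℝ, E) x₀ (g z)) y := by
  rw [← contMDiffAt_iff_contDiffAt]
  exact ContMDiffAt.comp y (contMDiffAt_extChartAt' (by rwa [extChartAt_source] at hy)) hg

theorem SmoothForm.contDiffAt {a : ℕ} {α : Form E M a} (hα : SmoothForm α) {x₀ : M} {y : E}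
    (hy : y ∈ (extChartAt 𝓘(ℝ, E) x₀).target) : ContDiffAt ℝ ∞ (formInChart x₀ α) y := by
  have h := hα x₀
  rw [Set.preimage_univ, Set.inter_univ] at h
  exact h.contDiffAt ((isOpen_extChartAt_target x₀).mem_nhds hy)

theorem pullbackForm_eventuallyEq {a : ℕ} {g : G → M} (α : Form E M a) {x₀ : M} {y : G}
    (hg : ContMDiffAt 𝓘(ℝ, G) 𝓘(ℝ, E) ∞ g y)
    (hy : g y ∈ (extChartAt 𝓘(ℝ, E) x₀).source) :
    pullbackForm g α =ᶠ[𝓝 y] fun y =>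
      (formInChart x₀ α (extChartAt 𝓘(ℝ, E) x₀ (g y))).compContinuousLinearMap
        (fderiv ℝ (fun z => extChartAt 𝓘(ℝ, E) x₀ (g z)) y) := by
  have h1 : ∀ᶠ z in 𝓝 y, ContMDiffAt 𝓘(ℝ, G) 𝓘(ℝ, E) 1 g z :=
    (contMDiffAt_iff_contMDiffAt_nhds (by simp)).1 (hg.of_le (by simp))
  have h2 : ∀ᶠ z in 𝓝 y, g z ∈ (extChartAt 𝓘(ℝ, E) x₀).source :=
    hg.continuousAt.eventually_mem ((isOpen_extChartAt_source x₀).mem_nhds hy)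
  filter_upwards [h1, h2] with z hz1 hz2
  exact pullbackForm_eq α (hz1.mdifferentiableAt (by simp)) hz2

theorem contDiffAt_pullbackForm [FiniteDimensional ℝ G] {a : ℕ} {g : G → M} {α : Form E M a}
    (hα : SmoothForm α) {y : G} (hg : ContMDiffAt 𝓘(ℝ, G) 𝓘(ℝ, E) ∞ g y) :
    ContDiffAt ℝ ∞ (pullbackForm g α) y := by
  have hy : g y ∈ (extChartAt 𝓘(ℝ, E) (g y)).source := mem_extChartAt_source (g y)
  refine ContDiffAt.congr_of_eventuallyEq ?_ (pullbackForm_eventuallyEq α hg hy)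
  have h1 := contDiffAt_chart_comp hg hy
  have h2 : ContDiffAt ℝ ∞ (fderiv ℝ (fun z => extChartAt 𝓘(ℝ, E) (g y) (g z))) y :=
    h1.fderiv_right (by simp)
  have h3 := (hα.contDiffAt (mem_extChartAt_target (g y))).comp y h1
  rw [← contDiffWithinAt_univ] at *
  exact contDiffWithinAt_alt_comp h3 h2

/-- The exterior derivative commutes with pullbacks. -/
theorem extDeriv_pullbackForm {a : ℕ} {g : G → M} {α : Form E M a}
    (hα : SmoothForm α) {y : G} (hg : ContMDiffAt 𝓘(ℝ, G) 𝓘(ℝ, E) ∞ g y) :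
    extDeriv (pullbackForm g α) y = pullbackForm g (d α) y := by
  have hy : g y ∈ (extChartAt 𝓘(ℝ, E) (g y)).source := mem_extChartAt_source (g y)
  rw [(pullbackForm_eventuallyEq α hg hy).extDeriv_eq]
  have h1 := contDiffAt_chart_comp hg hy
  have h3 := hα.contDiffAt (mem_extChartAt_target (g y))
  refine (extDeriv_pullback (f := fun z => extChartAt 𝓘(ℝ, E) (g y) (g z))
    (h3.differentiableAt (by simp)) h1 minSmoothness_two_le).trans ?_
  have h4 : fderiv ℝ (fun z => extChartAt 𝓘(ℝ, E) (g y) (g z)) y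
      = (chartDeriv E (g y) (g y)).comp (mfderiv 𝓘(ℝ, G) 𝓘(ℝ, E) g y : G →L[ℝ] E) := by
    rw [← mfderiv_eq_fderiv]
    exact mfderiv_comp y (mdifferentiableAt_extChartAt (by rwa [extChartAt_source] at hy))
      (hg.mdifferentiableAt (by simp))
  rw [h4]
  rfl

end Pullback

theorem contMDiffAt_extChartAt_symm {x₀ : M} {y : E} (hy : y ∈ (extChartAt 𝓘(ℝ, E) x₀).target) :
    ContMDiffAt 𝓘(ℝ, E) 𝓘(ℝ, E) ∞ (extChartAt 𝓘(ℝ, E) x₀).symm y :=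
  (contMDiffOn_extChartAt_symm x₀).contMDiffAt ((isOpen_extChartAt_target x₀).mem_nhds hy)

/-- Each value of `d α` is computed in a chart that varies with the point. A chart expression is a
pullback by the inverse chart, so naturality of `d` allows a fixed chart instead. -/
theorem formInChart_d {a : ℕ} {α : Form E M a} (hα : SmoothForm α) {x₀ : M} {y : E}
    (hy : y ∈ (extChartAt 𝓘(ℝ, E) x₀).target) :
    formInChart x₀ (d α) y = extDeriv (formInChart x₀ α) y :=
  (extDeriv_pullbackForm hα (contMDiffAt_extChartAt_symm hy)).symm

theorem smoothForm_iff {a : ℕ} {α : Form E M a} : SmoothForm α ↔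
    ∀ x₀ : M, ContDiffOn ℝ ∞ (formInChart x₀ α) (extChartAt 𝓘(ℝ, E) x₀).target := by
  simp only [SmoothForm, SmoothFormOn, Set.preimage_univ, Set.inter_univ]

theorem SmoothForm.d {a : ℕ} {α : Form E M a} (hα : SmoothForm α) : SmoothForm (d α) := by
  rw [smoothForm_iff] at *
  intro x₀
  refine (contDiffOn_extDeriv (isOpen_extChartAt_target x₀) (hα x₀)).congr ?_
  intro y hy
  exact formInChart_d (smoothForm_iff.2 hα) hy

theorem d_apply_eq_zero {a : ℕ} {α : Form E M a} {x : M}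
    (h : extDeriv (formInChart x α) (extChartAt 𝓘(ℝ, E) x x) = 0) : d α x = 0 := by
  rw [GDirac.d, h]; rfl

theorem d_d {a : ℕ} {α : Form E M a} (hα : SmoothForm α) : d (d α) = 0 := by
  funext x
  refine d_apply_eq_zero ?_
  have hx := mem_extChartAt_target (I := 𝓘(ℝ, E)) x
  have h1 : formInChart x (d α) =ᶠ[𝓝 (extChartAt 𝓘(ℝ, E) x x)] extDeriv (formInChart x α) := by
    filter_upwards [(isOpen_extChartAt_target x).mem_nhds hx] with y hy
    exact formInChart_d hα hy
  rw [h1.extDeriv_eq]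
  exact extDeriv_extDeriv_apply (hα.contDiffAt hx) minSmoothness_two_le

end Charts

section Semibasic

variable {E : Type*} [NormedAddCommGroup E] [NormedSpace ℝ E]
  {F : Type*} [NormedAddCommGroup F] [NormedSpace ℝ F] {T : E →L[ℝ] F}

/-- Each `K v - v` is vertical, so arguments may be replaced one at a time. -/
theorem IsSemibasic.comp_eq {K : E →L[ℝ] E} (hK : ∀ v, T (K v) = T v) :
    ∀ {a : ℕ} {η : Alt E a} (_ : IsSemibasic T η), η.compContinuousLinearMap K = η
  | 0, η, _ => ContinuousAlternatingMap.ext fun v => congrArg η (Subsingleton.elim _ _)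
  | a + 1, η, hη => by
    refine ContinuousAlternatingMap.ext fun v => ?_
    have h1 : η.curryLeft (K (v 0)) = η.curryLeft (v 0) := by
      rw [← sub_eq_zero, ← map_sub]
      exact isSemibasic_iff_curryLeft.1 hη _ (by rw [map_sub, hK, sub_self])
    have h2 := IsSemibasic.comp_eq hK (hη.curryLeft (v 0))
    have h3 : ∀ w : Fin (a + 1) → E, η w = η.curryLeft (w 0) (fun i => w i.succ) := by
      intro w
      rw [ContinuousAlternatingMap.curryLeft_apply_apply]
      exact congrArg η (Fin.cons_self_tail w).symm
    rw [ContinuousAlternatingMap.compContinuousLinearMap_apply, h3, h3 v]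
    exact (congrArg (fun ζ : Alt E a => ζ fun i => K (v i.succ)) h1).trans
      (congrArg (fun ζ : Alt E a => ζ fun i => v i.succ) h2)

theorem isSemibasic_compContinuousLinearMap {a : ℕ} (ζ : Alt F a) :
    IsSemibasic T (ζ.compContinuousLinearMap T) := by
  rintro v ⟨i, hi⟩
  exact ζ.map_coord_zero i hi

end Semibasic

/-! ### Operations on fields of forms. -/

section Forms

variable {E : Type*} [NormedAddCommGroup E] [NormedSpace ℝ E] [FiniteDimensional ℝ E]
  {M : Type*} [TopologicalSpace M] [ChartedSpace E M]

theorem formInChart_add {a : ℕ} (x₀ : M) (α β : Form E M a) :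
    formInChart x₀ (α + β) = formInChart x₀ α + formInChart x₀ β := rfl

theorem formInChart_smul {a : ℕ} (x₀ : M) (r : ℝ) (α : Form E M a) :
    formInChart x₀ (r • α) = r • formInChart x₀ α := rfl

/-- The exterior product of two fields of forms, with a prescribed degree. -/
def wdF {a b c : ℕ} (h : a + b = c) (α : Form E M a) (β : Form E M b) : Form E M c :=
  fun x => wd h (α x) (β x)

theorem formInChart_wdF {a b c : ℕ} (h : a + b = c) (x₀ : M) (α : Form E M a) (β : Form E M b) :
    formInChart x₀ (wdF h α β) = fun y => wd h (formInChart x₀ α y) (formInChart x₀ β y) :=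
  funext fun _ => wd_comp h _ _ _

theorem SmoothForm.add {a : ℕ} {α β : Form E M a} (hα : SmoothForm α) (hβ : SmoothForm β) :
    SmoothForm (α + β) := fun x₀ => (hα x₀).add (hβ x₀)

theorem SmoothForm.smul {a : ℕ} {α : Form E M a} (r : ℝ) (hα : SmoothForm α) :
    SmoothForm (r • α) := fun x₀ => (hα x₀).const_smul r

theorem smoothForm_zero {a : ℕ} : SmoothForm (0 : Form E M a) := fun x₀ => by
  have h : formInChart x₀ (0 : Form E M a) = fun _ => 0 := rfl
  rw [h]
  exact contDiffOn_const

theorem SmoothForm.wdF {a b c : ℕ} (h : a + b = c) {α : Form E M a} {β : Form E M b}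
    (hα : SmoothForm α) (hβ : SmoothForm β) : SmoothForm (wdF h α β) := fun x₀ => by
  rw [formInChart_wdF]
  exact fun y hy => contDiffWithinAt_wd h (hα x₀ y hy) (hβ x₀ y hy)

theorem SmoothForm.differentiableAt_chart [IsManifold 𝓘(ℝ, E) ∞ M] {a : ℕ} {α : Form E M a}
    (hα : SmoothForm α) (x : M) :
    DifferentiableAt ℝ (formInChart x α) (extChartAt 𝓘(ℝ, E) x x) :=
  (hα.contDiffAt (mem_extChartAt_target x)).differentiableAt (by simp)

theorem d_add [IsManifold 𝓘(ℝ, E) ∞ M] {a : ℕ} {α β : Form E M a} (hα : SmoothForm α)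
    (hβ : SmoothForm β) : d (α + β) = d α + d β := by
  funext x
  rw [Pi.add_apply, d, d, d, formInChart_add,
    extDeriv_add (hα.differentiableAt_chart x) (hβ.differentiableAt_chart x)]
  rfl

theorem d_smul {a : ℕ} (r : ℝ) (α : Form E M a) : d (r • α) = r • d α := by
  funext x
  rw [Pi.smul_apply, d, d, formInChart_smul, extDeriv_smul]
  rfl

theorem d_zero {a : ℕ} : d (0 : Form E M a) = 0 := by
  have h := d_smul 0 (0 : Form E M a)
  rwa [zero_smul, zero_smul] at h

theorem extDeriv_formInChart_eq_zero [IsManifold 𝓘(ℝ, E) ∞ M] {a : ℕ} {α : Form E M a} {x : M}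
    (h : d α x = 0) : extDeriv (formInChart x α) (extChartAt 𝓘(ℝ, E) x x) = 0 := by
  have hx := mem_extChartAt_target (I := 𝓘(ℝ, E)) x
  have h1 := chartDeriv_comp_chartSymmDeriv (E := E) hx
  rw [(extChartAt 𝓘(ℝ, E) x).left_inv (mem_extChartAt_source x)] at h1
  rw [← alt_comp_id (extDeriv (formInChart x α) (extChartAt 𝓘(ℝ, E) x x)), ← h1, ← alt_comp_comp]
  exact (congrArg (fun ζ : Alt E (a + 1) => ζ.compContinuousLinearMap
    (chartSymmDeriv E x (extChartAt 𝓘(ℝ, E) x x))) h).trans rfl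

/-- Leibniz rule for a closed second factor. -/
theorem d_wdF [IsManifold 𝓘(ℝ, E) ∞ M] {a b c : ℕ} (h : a + b = c) (h' : a + 1 + b = c + 1)
    {α : Form E M a} {ε : Form E M b} (hα : SmoothForm α) (hε : SmoothForm ε) (hdε : d ε = 0) :
    d (wdF h α ε) = wdF h' (d α) ε := by
  funext x
  have h1 := extDeriv_formInChart_eq_zero (congrFun hdε x)
  rw [d, formInChart_wdF, extDeriv_wd h (hα.differentiableAt_chart x)
    (hε.differentiableAt_chart x), h1, wd_zero, smul_zero, add_zero, wd_comp,
    formInChart_comp_chartDeriv _ (mem_extChartAt_source x)]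
  rfl

theorem slice_comp {E' : Type*} [NormedAddCommGroup E'] [NormedSpace ℝ E'] {p c : ℕ}
    (α : Alt E (p + c)) (w : Fin c → E') (L : E' →L[ℝ] E) :
    slice (α.compContinuousLinearMap L) w
      = (slice α (fun i => L (w i))).compContinuousLinearMap L := by
  refine ContinuousAlternatingMap.ext fun v => ?_
  refine congrArg α (funext fun j => ?_)
  refine Fin.addCases (fun k => ?_) (fun k => ?_) j <;> simp

theorem SmoothForm.interiorF [IsManifold 𝓘(ℝ, E) ∞ M] {p c a : ℕ} (h : p + c = a)
    {U : MVField E M p} {α : Form E M a} (hU : SmoothMV U) (hα : SmoothForm α) :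
    SmoothForm (interiorF h U α) := by
  subst h
  intro x₀ y hy
  refine contDiffWithinAt_of_eval fun w => ?_
  -- In a chart the slice is expanded in constant forms: its coefficients are smooth because `α` is,
  -- and the pairings of `U` with the constant forms are smooth by definition.
  let b := Module.finBasis ℝ (Alt E p)
  have hs : ContDiffWithinAt ℝ ∞ (fun z => slice (formInChart x₀ α z) w)
      ((extChartAt 𝓘(ℝ, E) x₀).target ∩ (extChartAt 𝓘(ℝ, E) x₀).symm ⁻¹' Set.univ) y :=
    contDiffWithinAt_of_eval fun v => contDiffWithinAt_alt_apply_const (hα x₀ y hy) _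
  have key : ∀ z ∈ (extChartAt 𝓘(ℝ, E) x₀).target ∩ (extChartAt 𝓘(ℝ, E) x₀).symm ⁻¹' Set.univ,
      formInChart x₀ (GDirac.interiorF rfl U α) z w
        = ∑ i, b.repr (slice (formInChart x₀ α z) w) i *
          U ((extChartAt 𝓘(ℝ, E) x₀).symm z) ((b i).compContinuousLinearMap
            (chartDeriv E x₀ ((extChartAt 𝓘(ℝ, E) x₀).symm z))) := by
    intro z hz
    have h1 := chartSymmDeriv_comp_chartDeriv (E := E) ((extChartAt 𝓘(ℝ, E) x₀).map_target hz.1)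
    rw [(extChartAt 𝓘(ℝ, E) x₀).right_inv hz.1] at h1
    have h2 : slice (α ((extChartAt 𝓘(ℝ, E) x₀).symm z)) (fun i => chartSymmDeriv E x₀ z (w i))
        = (slice (formInChart x₀ α z) w).compContinuousLinearMap
            (chartDeriv E x₀ ((extChartAt 𝓘(ℝ, E) x₀).symm z)) := by
      rw [formInChart, slice_comp, alt_comp_comp, h1, alt_comp_id]
    have h3 : formInChart x₀ (GDirac.interiorF rfl U α) z w
        = U ((extChartAt 𝓘(ℝ, E) x₀).symm z) (slice (α ((extChartAt 𝓘(ℝ, E) x₀).symm z))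
          (fun i => chartSymmDeriv E x₀ z (w i))) := rfl
    rw [h3, h2]
    conv_lhs => rw [← b.sum_repr (slice (formInChart x₀ α z) w)]
    have h4 : (∑ i, b.repr (slice (formInChart x₀ α z) w) i • b i).compContinuousLinearMap
        (chartDeriv E x₀ ((extChartAt 𝓘(ℝ, E) x₀).symm z))
        = ∑ i, b.repr (slice (formInChart x₀ α z) w) i • (b i).compContinuousLinearMap
          (chartDeriv E x₀ ((extChartAt 𝓘(ℝ, E) x₀).symm z)) := by
      refine ContinuousAlternatingMap.ext fun v => ?_
      simp only [ContinuousAlternatingMap.compContinuousLinearMap_apply,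
        ContinuousAlternatingMap.sum_apply, ContinuousAlternatingMap.smul_apply]
    rw [h4, map_sum]
    simp only [map_smul, smul_eq_mul]
  refine ContDiffWithinAt.congr_of_mem ?_ key hy
  refine ContDiffWithinAt.sum fun i _ => ContDiffWithinAt.mul ?_ (hU x₀ (b i) y hy)
  exact (LinearMap.toContinuousLinearMap (b.coord i)).contDiff.comp_contDiffWithinAt hs

end Forms

/-! ### Closed basic forms with prescribed value at a point. -/

section Basic

variable {E : Type*} [NormedAddCommGroup E] [NormedSpace ℝ E] [FiniteDimensional ℝ E]
  {M : Type*} [TopologicalSpace M] [ChartedSpace E M] [IsManifold 𝓘(ℝ, E) ∞ M]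
  {F : Type*} [NormedAddCommGroup F] [NormedSpace ℝ F] [FiniteDimensional ℝ F]
  {X : Type*} [TopologicalSpace X] [ChartedSpace F X] [IsManifold 𝓘(ℝ, F) ∞ X]

/-- The pullback of a constant form by a map to a vector space. -/
def constPullback (ψ : M → F) {a : ℕ} (ζ : Alt F a) : Form E M a :=
  fun x => ζ.compContinuousLinearMap (dmap E F ψ x)

theorem contDiffAt_comp_chart_symm {ψ : M → F} (hψ : ContMDiff 𝓘(ℝ, E) 𝓘(ℝ, F) ∞ ψ) {x₀ : M} {y : E}
    (hy : y ∈ (extChartAt 𝓘(ℝ, E) x₀).target) :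
    ContDiffAt ℝ ∞ (fun z => ψ ((extChartAt 𝓘(ℝ, E) x₀).symm z)) y := by
  rw [← contMDiffAt_iff_contDiffAt]
  exact hψ.contMDiffAt.comp y (contMDiffAt_extChartAt_symm hy)

theorem formInChart_constPullback {ψ : M → F} (hψ : ContMDiff 𝓘(ℝ, E) 𝓘(ℝ, F) ∞ ψ) {a : ℕ}
    (ζ : Alt F a) {x₀ : M} {y : E} (hy : y ∈ (extChartAt 𝓘(ℝ, E) x₀).target) :
    formInChart x₀ (constPullback (E := E) ψ ζ) y = ζ.compContinuousLinearMap
      (fderiv ℝ (fun z => ψ ((extChartAt 𝓘(ℝ, E) x₀).symm z)) y) := by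
  rw [formInChart, constPullback, alt_comp_comp, ← mfderiv_eq_fderiv]
  refine congrArg (fun L => ζ.compContinuousLinearMap L) ?_
  exact (mfderiv_comp y (hψ.mdifferentiable (by simp) _)
    ((contMDiffAt_extChartAt_symm hy).mdifferentiableAt (by simp))).symm

theorem smoothForm_constPullback {ψ : M → F} (hψ : ContMDiff 𝓘(ℝ, E) 𝓘(ℝ, F) ∞ ψ) {a : ℕ}
    (ζ : Alt F a) : SmoothForm (constPullback (E := E) ψ ζ) := by
  rw [smoothForm_iff]
  intro x₀
  refine ContDiffOn.congr (fun y hy => ?_) fun y hy => formInChart_constPullback hψ ζ hy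
  have h1 := (contDiffAt_comp_chart_symm hψ hy).fderiv_right (m := ∞) (by simp)
  exact contDiffWithinAt_alt_comp contDiffWithinAt_const h1.contDiffWithinAt

theorem d_constPullback {ψ : M → F} (hψ : ContMDiff 𝓘(ℝ, E) 𝓘(ℝ, F) ∞ ψ) {a : ℕ}
    (ζ : Alt F a) : d (constPullback (E := E) ψ ζ) = 0 := by
  funext x
  refine d_apply_eq_zero ?_
  have hx := mem_extChartAt_target (I := 𝓘(ℝ, E)) x
  have h1 : formInChart x (constPullback (E := E) ψ ζ) =ᶠ[𝓝 (extChartAt 𝓘(ℝ, E) x x)] fun y =>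
      ζ.compContinuousLinearMap (fderiv ℝ (fun z => ψ ((extChartAt 𝓘(ℝ, E) x).symm z)) y) := by
    filter_upwards [(isOpen_extChartAt_target x).mem_nhds hx] with y hy
    exact formInChart_constPullback hψ ζ hy
  rw [h1.extDeriv_eq]
  refine (extDeriv_pullback (F := F) (f := fun z => ψ ((extChartAt 𝓘(ℝ, E) x).symm z)) (differentiableAt_const ζ)
    (contDiffAt_comp_chart_symm hψ hx) minSmoothness_two_le).trans ?_
  have h2 : extDeriv (fun _ : F => ζ) (ψ ((extChartAt 𝓘(ℝ, E) x).symm (extChartAt 𝓘(ℝ, E) x x)))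
      = 0 := by
    rw [extDeriv, fderiv_fun_const]
    exact map_zero (ContinuousAlternatingMap.alternatizeUncurryFinCLM ℝ F ℝ)
  rw [h2]
  rfl

theorem IsBasic.smoothForm {τ : M → X} (hτ : ContMDiff 𝓘(ℝ, E) 𝓘(ℝ, F) ∞ τ) {b : ℕ}
    {ε : Form E M b} (hε : IsBasic F τ ε) : SmoothForm ε := by
  obtain ⟨η, hη, h⟩ := hε
  rw [smoothForm_iff]
  intro x₀
  have h1 : ∀ y ∈ (extChartAt 𝓘(ℝ, E) x₀).target, formInChart x₀ ε y
      = pullbackForm (G := E) (fun z => τ ((extChartAt 𝓘(ℝ, E) x₀).symm z)) η y := by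
    intro y hy
    rw [formInChart, h, pullbackForm, alt_comp_comp]
    refine congrArg (fun L => (η _).compContinuousLinearMap L) ?_
    exact (mfderiv_comp y (hτ.mdifferentiable (by simp) _)
      ((contMDiffAt_extChartAt_symm hy).mdifferentiableAt (by simp))).symm
  refine ContDiffOn.congr (fun y hy => ?_) h1
  exact (contDiffAt_pullbackForm hη
    (hτ.contMDiffAt.comp y (contMDiffAt_extChartAt_symm hy))).contDiffWithinAt

theorem IsBasic.isSemibasic {τ : M → X} {b : ℕ} {ε : Form E M b} (hε : IsBasic F τ ε) (x : M) :
    IsSemibasic (dmap E F τ x) (ε x) := by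
  obtain ⟨η, -, h⟩ := hε
  rw [h]
  exact isSemibasic_compContinuousLinearMap _

theorem IsClosedBasic.wdF {τ : M → X} (hτ : ContMDiff 𝓘(ℝ, E) 𝓘(ℝ, F) ∞ τ) {a b c : ℕ} (h : a + b = c)
    {α : Form E M a} {β : Form E M b}
    (hα : IsClosedBasic F τ α) (hβ : IsClosedBasic F τ β) : IsClosedBasic F τ (wdF h α β) := by
  refine ⟨?_, ?_⟩
  · obtain ⟨ζ, hζ, h1⟩ := hα.1
    obtain ⟨η, hη, h2⟩ := hβ.1
    refine ⟨GDirac.wdF h ζ η, SmoothForm.wdF h hζ hη, fun x => ?_⟩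
    rw [GDirac.wdF, GDirac.wdF, wd_comp, h1, h2]
  · rw [d_wdF h (by omega) (IsBasic.smoothForm hτ hα.1)
      (IsBasic.smoothForm hτ hβ.1) hβ.2, hα.2]
    exact funext fun x => zero_wd _ _

/-- A chart multiplied by a bump function is globally smooth and agrees with the chart near `z`. -/
theorem exists_contMDiff_mfderiv_invertible [T2Space X] (z : X) :
    ∃ φ : X → F, ContMDiff 𝓘(ℝ, F) 𝓘(ℝ, F) ∞ φ ∧ ∃ L : F →L[ℝ] F,
      L.comp (dmap F F φ z) = ContinuousLinearMap.id ℝ F := by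
  obtain ⟨f⟩ : Nonempty (SmoothBumpFunction 𝓘(ℝ, F) z) := inferInstance
  refine ⟨fun x => f x • extChartAt 𝓘(ℝ, F) z x, f.contMDiff_smul contMDiffOn_extChartAt,
    chartSymmDeriv F z (extChartAt 𝓘(ℝ, F) z z), ?_⟩
  have h1 : (fun x => f x • extChartAt 𝓘(ℝ, F) z x) =ᶠ[𝓝 z] extChartAt 𝓘(ℝ, F) z := by
    filter_upwards [f.eventuallyEq_one] with x hx
    rw [hx, Pi.one_apply, one_smul]
  have h2 : dmap F F (fun x => f x • extChartAt 𝓘(ℝ, F) z x) z = chartDeriv F z z := h1.mfderiv_eq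
  rw [h2]
  exact chartSymmDeriv_comp_chartDeriv (mem_extChartAt_source z)

/-- Every semi-basic form at a point is the value of a closed basic form. -/
theorem exists_isClosedBasic [T2Space X] {τ : M → X} (hτ : IsFiberedManifold E F τ) (x : M) {b : ℕ}
    {η : Alt E b} (hη : IsSemibasic (dmap E F τ x) η) :
    ∃ ε : Form E M b, IsClosedBasic F τ ε ∧ ε x = η := by
  obtain ⟨φ, hφ, L, hL⟩ := exists_contMDiff_mfderiv_invertible (F := F) (τ x)
  obtain ⟨R, hR⟩ := (dmap E F τ x : E →ₗ[ℝ] F).exists_rightInverse_of_surjective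
    (LinearMap.range_eq_top.2 (hτ.submersion x))
  let R' : F →L[ℝ] E := LinearMap.toContinuousLinearMap R
  -- A constant form on `F`, so its pullback is closed. With `R'` a right inverse of `dτ` and `L` a
  -- left inverse of `dφ`, its pullback at `x` is `η` composed with `R' ∘ dτ`, which is `η` because
  -- `η` is semi-basic.
  let ζ : Alt F b := η.compContinuousLinearMap (R'.comp L)
  have h1 : ∀ z, dmap E F (φ ∘ τ) z
      = (dmap F F φ (τ z)).comp (dmap E F τ z) := fun z =>
    mfderiv_comp z (hφ.mdifferentiable (by simp) _) (hτ.smooth.mdifferentiable (by simp) _)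
  refine ⟨constPullback (φ ∘ τ) ζ, ⟨⟨constPullback φ ζ, smoothForm_constPullback hφ ζ, ?_⟩,
    d_constPullback (hφ.comp hτ.smooth) ζ⟩, ?_⟩
  · intro z
    rw [constPullback, h1]
    rfl
  · have h2 : (R'.comp L).comp ((dmap F F φ (τ x)).comp (dmap E F τ x))
        = R'.comp (dmap E F τ x) := by
      rw [ContinuousLinearMap.comp_assoc, ← ContinuousLinearMap.comp_assoc L, hL,
        ContinuousLinearMap.id_comp]
    rw [constPullback, h1, alt_comp_comp, h2]
    exact hη.comp_eq fun v => LinearMap.congr_fun hR (dmap E F τ x v)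

end Basic

/-! ### Pointwise consequences of vertical values and skew symmetry. -/

namespace GradedDirac

variable {E : Type*} [NormedAddCommGroup E] [NormedSpace ℝ E] [FiniteDimensional ℝ E]
  {M : Type*} [TopologicalSpace M] [ChartedSpace E M]
  {F : Type*} [NormedAddCommGroup F] [NormedSpace ℝ F]
  {X : Type*} [TopologicalSpace X] [ChartedSpace F X] {τ : M → X}
  {n : ℕ} {D : GradedDirac E M n}

theorem SharpVertical.dmap_eq_zero (hv : D.SharpVertical F τ) {m : ℕ} (hm : m + 1 = n) {x : M}
    {σ : Alt E (m + 1)} (hσ : σ ∈ D.S (m + 1) x) {C : ℝ} (hC : C ≠ 0) {u : E}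
    (h : D.sharp (m + 1) 1 x ⟨σ, hσ⟩ = Submodule.Quotient.mk (C • vecMV u)) :
    dmap E F τ x u = 0 := by
  subst hm
  have h1 := hv x ⟨σ, hσ⟩ (C • u) (C • vecMV u) (fun ζ => by
    rw [LinearMap.smul_apply, vecMV_apply]
    have := ζ.map_smul_univ (fun _ => C) (fun _ => u)
    rw [this, Fin.prod_univ_one]) h
  rw [map_smul] at h1
  exact (smul_eq_zero.1 h1).resolve_left hC

variable (D F τ) in
/-- `ι_ε U` represents, up to a nonzero factor, the class `♯(A ∧ ε)`, for all semi-basic `ε` at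
`x` of the complementary degree. -/
def ContractionRep {a p m : ℕ} (h : a + 1 + p = m + 1) (x : M) (A : Alt E (a + 1))
    (U : MVec E (p + 1)) : Prop :=
  ∀ ε : Alt E p, IsSemibasic (dmap E F τ x) ε → ∃ C : ℝ, C ≠ 0 ∧
    ∃ hA : wd h A ε ∈ D.S (m + 1) x,
      D.sharp (m + 1) 1 x ⟨wd h A ε, hA⟩ = Submodule.Quotient.mk (C • contractForm rfl ε U)

variable {a b p q m : ℕ} {ha : a + 1 + p = m + 1} {hb : b + 1 + q = m + 1} {x : M}
  {A : Alt E (a + 1)} {B : Alt E (b + 1)} {U : MVec E (p + 1)} {V : MVec E (q + 1)}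

theorem ContractionRep.exists_vertical (hv : D.SharpVertical F τ) (hm : m + 1 = n)
    (hB : D.ContractionRep F τ hb x B V) {ε : Alt E q} (hε : IsSemibasic (dmap E F τ x) ε) :
    ∃ u, contractForm rfl ε V = vecMV u ∧ dmap E F τ x u = 0 := by
  obtain ⟨C, hC, hmem, h⟩ := hB ε hε
  obtain ⟨u, hu⟩ := exists_vecMV (contractForm rfl ε V : MVec E 1)
  exact ⟨u, hu, hv.dmap_eq_zero hm hmem hC (by rw [h, hu])⟩

/-- Semi-basic forms are combinations of products `l ∧ η`, and up to sign `V` pairs with such a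
product as `l` does with the vertical vector `ι_η V`, that is, to zero. -/
theorem ContractionRep.apply_semibasic (hv : D.SharpVertical F τ) (hm : m + 1 = n)
    (hB : D.ContractionRep F τ hb x B V) (Φ : HorizontalFrame (dmap E F τ x) n)
    {σ : Alt E (q + 1)} (hσ : IsSemibasic (dmap E F τ x) σ) : V σ = 0 := by
  refine Φ.semibasic_induction (P := fun σ => V σ = 0) (map_zero V)
    (fun σ σ' h h' => by rw [map_add, h, h', add_zero])
    (fun r σ h => by rw [map_smul, h, smul_zero]) (fun l hl η hη => ?_) hσ
  obtain ⟨u, hu, hTu⟩ := hB.exists_vertical hv hm hη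
  let one : Alt E 0 := ContinuousAlternatingMap.constOfIsEmpty ℝ E (Fin 0) (1 : ℝ)
  have h1 : contractForm rfl η V (covecWedge l one) = 0 := by
    rw [hu, vecMV_apply, covecWedge_apply]
    simp [hl u hTu]
  have h2 : one Fin.elim0 = 1 := rfl
  rw [contractForm_apply, wd_covecWedge (Nat.add_zero q), wd_degree_zero, h2, one_smul,
    map_smul] at h1
  exact (smul_eq_zero.1 h1).resolve_left (pow_ne_zero _ (by norm_num))

/-- Tested against a semi-basic `η`, skew symmetry for `A ∧ η` and `B ∧ ε` makes `(ι_{ι_ε V} A) ∧ η`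
proportional to `(ι_{ι_η U} B) ∧ ε`, since both vectors are vertical. The latter is annihilated by
`l` whenever `ε` is, and the perfect pairing removes `η`. -/
theorem ContractionRep.covecWedge_interior_eq_zero (hv : D.SharpVertical F τ) (hm : m + 1 = n)
    (hA : D.ContractionRep F τ ha x A U) (hB : D.ContractionRep F τ hb x B V)
    (hAv : VertDegreeLeOne (dmap E F τ x) A) (Φ : HorizontalFrame (dmap E F τ x) n)
    {l : E →L[ℝ] ℝ} (hl : IsSemibasicCovec (dmap E F τ x) l) {ε : Alt E q}
    (hε : IsSemibasic (dmap E F τ x) ε) (hlε : covecWedge l ε = 0) (h1a : 1 + a = a + 1) :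
    covecWedge l (interior h1a (contractForm rfl ε V) A) = 0 := by
  obtain ⟨C₂, hC₂, hmem₂, h₂⟩ := hB ε hε
  obtain ⟨v, hvε, hTv⟩ := hB.exists_vertical hv hm hε
  rw [hvε, interior_vecMV _ rfl, castDeg_rfl]
  refine Φ.eq_zero_of_wd (q := p) ha hm.le (hl.covecWedge (hAv.curryLeft hTv)) fun η hη => ?_
  obtain ⟨C₁, hC₁, hmem₁, h₁⟩ := hA η hη
  obtain ⟨u, huη, hTu⟩ := hA.exists_vertical hv hm hη
  have h3 := D.skew (m + 1) (m + 1) m 1 1 (by omega) hm.le (by omega) hm.le (by omega) (by omega)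
    (by omega) (by omega) x ⟨_, hmem₁⟩ ⟨_, hmem₂⟩ _ _ h₁ h₂
  rw [smul_interior, smul_interior, huη, hvε, interior_vecMV _ rfl, interior_vecMV _ rfl,
    castDeg_rfl, castDeg_rfl, curryLeft_wd hTu hε (by omega), curryLeft_wd hTv hη (by omega),
    smul_smul] at h3
  have h4 := congrArg (covecWedge l) h3
  have h5 : covecWedge l (wd (by omega : b + q = m) (B.curryLeft u) ε) = 0 := by
    have h6 := wd_covecWedge (by omega : b + q = m) (by omega) l (B.curryLeft u) ε
    rw [hlε, wd_zero] at h6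
    exact (smul_eq_zero.1 h6.symm).resolve_left (pow_ne_zero _ (by norm_num))
  rw [covecWedge_smul, covecWedge_smul, h5, smul_zero] at h4
  rw [covecWedge_wd (by omega : a + p = m)]
  exact (smul_eq_zero.1 h4.symm).resolve_left (mul_ne_zero (by norm_num) hC₂)

/-- Contracting `A ∧ ε₁` with `ι_{ε₂} V` is, up to a universal factor, `(ι_V A) ∧ ε₂ ∧ ε₁`. -/
theorem ContractionRep.interior_wd (hv : D.SharpVertical F τ) (hm : m + 1 = n)
    (hB : D.ContractionRep F τ hb x B V)
    {c : ℕ} (hqc : q + 1 + c = a + 1) (hcq : c + q = a) (hap : a + p = m) (h1m : 1 + m = m + 1)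
    {κ : ℝ} (hκ : κ ≠ 0) (h1a : 1 + a = a + 1)
    (key : ∀ ε : Alt E q, IsSemibasic (dmap E F τ x) ε →
      wd hcq (interior hqc V A) ε = κ • interior h1a (contractForm rfl ε V) A)
    {ε₁ : Alt E p} {ε₂ : Alt E q} (hε₁ : IsSemibasic (dmap E F τ x) ε₁)
    (hε₂ : IsSemibasic (dmap E F τ x) ε₂) :
    interior h1m (contractForm rfl ε₂ V) (wd ha A ε₁)
      = κ⁻¹ • wd hap (wd hcq (interior hqc V A) ε₂) ε₁ := by
  obtain ⟨v, hvε, hTv⟩ := hB.exists_vertical hv hm hε₂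
  rw [key ε₂ hε₂, smul_wd, inv_smul_smul₀ hκ, hvε, interior_vecMV _ rfl, interior_vecMV _ rfl,
    castDeg_rfl, castDeg_rfl, curryLeft_wd hTv hε₁ hap]

end GradedDirac

/-! ### Brackets of special Hamiltonian forms. -/

namespace GradedDirac

variable {E : Type*} [NormedAddCommGroup E] [NormedSpace ℝ E] [FiniteDimensional ℝ E]
  {M : Type*} [TopologicalSpace M] [ChartedSpace E M] [IsManifold 𝓘(ℝ, E) ∞ M]
  {F : Type*} [NormedAddCommGroup F] [NormedSpace ℝ F] [FiniteDimensional ℝ F]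
  {X : Type*} [TopologicalSpace X] [ChartedSpace F X] [IsManifold 𝓘(ℝ, F) ∞ X] {τ : M → X}
  {n : ℕ} {D : GradedDirac E M n}

theorem isHamiltonian_zero {a : ℕ} (ha : a + 1 ≤ n) : D.IsHamiltonian a 0 :=
  ⟨ha, smoothForm_zero, fun x => by rw [d_zero]; exact (D.S (a + 1) x).zero_mem⟩

theorem IsHamiltonian.add {a : ℕ} {α β : Form E M a} (hα : D.IsHamiltonian a α)
    (hβ : D.IsHamiltonian a β) : D.IsHamiltonian a (α + β) :=
  ⟨hα.1, hα.2.1.add hβ.2.1, fun x => by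
    rw [d_add hα.2.1 hβ.2.1]; exact (D.S (a + 1) x).add_mem (hα.2.2 x) (hβ.2.2 x)⟩

theorem IsHamiltonian.smul {a : ℕ} {α : Form E M a} (r : ℝ) (hα : D.IsHamiltonian a α) :
    D.IsHamiltonian a (r • α) :=
  ⟨hα.1, hα.2.1.smul r, fun x => by
    rw [d_smul]; exact (D.S (a + 1) x).smul_mem r (hα.2.2 x)⟩

/-- The special Hamiltonian `a`-forms, as a linear subspace. -/
def specialForms (D : GradedDirac E M n) (F : Type*) [NormedAddCommGroup F] [NormedSpace ℝ F]
    {X : Type*} [TopologicalSpace X] [ChartedSpace F X] (τ : M → X) (a : ℕ) (ha : a + 1 ≤ n) :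
    Submodule ℝ (Form E M a) where
  carrier := {α | D.IsSpecial F τ a α}
  zero_mem' := ⟨isHamiltonian_zero ha, fun c hc ε _ => by
    have h : wedgeF (0 : Form E M a) ε = 0 := funext fun x => zero_wd rfl (ε x)
    rw [h]
    exact isHamiltonian_zero hc.le⟩
  add_mem' {α β} hα hβ := ⟨hα.1.add hβ.1, fun c hc ε hε => by
    have h : wedgeF (α + β) ε = wedgeF α ε + wedgeF β ε :=
      funext fun x => add_wd rfl (α x) (β x) (ε x)
    rw [h]
    exact (hα.2 c hc ε hε).add (hβ.2 c hc ε hε)⟩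
  smul_mem' r α hα := ⟨hα.1.smul r, fun c hc ε hε => by
    have h : wedgeF (r • α) ε = r • wedgeF α ε := funext fun x => smul_wd rfl r (α x) (ε x)
    rw [h]
    exact (hα.2 c hc ε hε).smul r⟩

theorem IsSpecial.isHamiltonian_wdF {a c e : ℕ} {α : Form E M a} (hα : D.IsSpecial F τ a α)
    (h : a + c = e) (he : e + 1 = n) {ε : Form E M c} (hε : IsClosedBasic F τ ε) :
    D.IsHamiltonian e (wdF h α ε) := by
  subst h
  exact hα.2 c he ε hε

/-- In degree `n - 1` the complementary forms are functions, which can be absorbed into `e`. Staying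
within special forms matters because representatives of `♯` are provided only for these. -/
theorem IsSpecial.wdF (hτ : ContMDiff 𝓘(ℝ, E) 𝓘(ℝ, F) ∞ τ) {a p m : ℕ} {α : Form E M a}
    (hα : D.IsSpecial F τ a α) (h : a + p = m) (hm : m + 1 = n) {e : Form E M p}
    (he : IsClosedBasic F τ e) : D.IsSpecial F τ m (wdF h α e) := by
  refine ⟨hα.isHamiltonian_wdF h hm he, fun c hc ε hε => ?_⟩
  obtain rfl : c = 0 := by omega
  have h1 : wedgeF (GDirac.wdF h α e) ε = GDirac.wdF h α (GDirac.wdF (Nat.add_zero p) e ε) := by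
    funext x
    refine (wd_degree_zero _ _).trans ?_
    rw [GDirac.wdF, GDirac.wdF, GDirac.wdF, wd_degree_zero, wd_smul]
  rw [h1]
  exact hα.isHamiltonian_wdF h hm (he.wdF hτ _ hε)

theorem interior_zero {p c a : ℕ} (h : p + c = a) (U : MVec E p) :
    interior h U (0 : Alt E a) = 0 := by
  have h1 := interior_smul h U 0 (0 : Alt E a)
  rwa [zero_smul, zero_smul] at h1

theorem lieDeriv_of_closed {p c b : ℕ} (h : p + c = b) (U : MVField E M p) {β : Form E M b}
    (hβ : d β = 0) : lieDeriv h U β = d (interiorF h U β) := by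
  have h1 : interiorF (by omega : p + (c + 1) = b + 1) U (d β) = 0 := by
    rw [hβ]
    exact funext fun x => interior_zero _ _
  rw [lieDeriv, h1, smul_zero, sub_zero]

/-- Closedness reduces both Lie derivatives to differentials of contractions, and skew symmetry
makes these contractions equal up to sign; the second Lie derivative then cancels against the
half-differential term. -/
theorem integrabilityForm_of_closed {a b c p q : ℕ} (hU : p + 1 + c = b) (hV : q + 1 + c = a)
    {α : Form E M a} {β : Form E M b} {U : MVField E M (p + 1)} {V : MVField E M (q + 1)}
    (hα : d α = 0) (hβ : d β = 0)
    (h : interiorF hU U β = (-1 : ℝ) ^ ((p + 1) * (q + 1)) • interiorF hV V α) :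
    integrabilityForm hU hV α β U V = (-1 : ℝ) ^ (q + 1) • d (interiorF hV V α) := by
  have h1 : interiorF hV V α + (-1 : ℝ) ^ ((p + 1) * (q + 1)) • interiorF hU U β
      = (2 : ℝ) • interiorF hV V α := by
    rw [h, smul_smul, ← mul_pow, neg_one_mul, neg_neg, one_pow, one_smul, two_smul]
  rw [integrabilityForm, lieDeriv_of_closed hU U hβ, lieDeriv_of_closed hV V hα, h1, h, d_smul,
    d_smul, smul_smul, smul_smul, ← pow_add, div_mul_cancel₀ _ two_ne_zero, add_sub_cancel_right]
  congr 1
  rw [show p * (q + 1) + (p + 1) * (q + 1) = 2 * (p * (q + 1)) + (q + 1) by ring, pow_add, pow_mul]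
  simp

/-- The bracket of Hamiltonian forms is Hamiltonian, provided that the classes `♯(dα)` and `♯(dβ)`
have smooth representatives. -/
theorem IsHamiltonian.bracket {a b c k p : ℕ} (hk : b + k = n) (hc : k + c = a + 1)
    (hp : a + p = n) {α : Form E M a} {β : Form E M b} (hα : D.IsHamiltonian a α)
    (hβ : D.IsHamiltonian b β) {U : MVField E M p} {V : MVField E M k} (hU : SmoothMV U)
    (hV : SmoothMV V)
    (hαU : ∀ x, D.sharp (a + 1) p x ⟨d α x, hα.2.2 x⟩ = Submodule.Quotient.mk (U x))
    (hβV : ∀ x, D.sharp (b + 1) k x ⟨d β x, hβ.2.2 x⟩ = Submodule.Quotient.mk (V x)) :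
    D.IsHamiltonian c (D.bracket hk hc α β hβ) := by
  have ha1 := hα.1
  have hb1 := hβ.1
  obtain ⟨q, rfl⟩ : ∃ q, k = q + 1 := ⟨k - 1, by omega⟩
  obtain ⟨p, rfl⟩ : ∃ p', p = p' + 1 := ⟨p - 1, by omega⟩
  have h1 : D.bracket hk hc α β hβ = (-1 : ℝ) ^ (n - 1 - b) • interiorF hc V (d α) :=
    funext fun x => D.bracket_eq hk hc α β hα hβ x (V x) (hβV x)
  have hUc : p + 1 + c = b + 1 := by omega
  have h2 : interiorF hUc U (d β)
      = (-1 : ℝ) ^ ((p + 1) * (q + 1)) • interiorF hc V (d α) :=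
    funext fun x => D.skew (a + 1) (b + 1) c (p + 1) (q + 1) (by omega) ha1 (by omega) hb1
      (by omega) (by omega) hUc hc x ⟨_, hα.2.2 x⟩ ⟨_, hβ.2.2 x⟩ _ _ (hαU x) (hβV x)
  obtain ⟨h3, -⟩ := D.integrable (a + 1) (b + 1) c p q (by omega) (by omega) (by omega) (by omega)
    hUc hc (d α) (d β) hα.2.2 hβ.2.2 U V hα.2.1.d hβ.2.1.d hU hV hαU hβV
  rw [integrabilityForm_of_closed hUc hc (d_d hα.2.1) (d_d hβ.2.1) h2] at h3
  refine ⟨by omega, ?_, fun x => ?_⟩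
  · rw [h1]
    exact (SmoothForm.interiorF hc hV hα.2.1.d).smul _
  · rw [h1, d_smul]
    have h4 := (D.S (c + 1) x).smul_mem ((-1 : ℝ) ^ (q + 1)) (h3 x)
    rw [Pi.smul_apply, smul_smul, ← mul_pow, neg_one_mul, neg_neg, one_pow, one_smul] at h4
    exact (D.S (c + 1) x).smul_mem _ h4

theorem sharp_castDeg {a b : ℕ} (h : a = b) (p : ℕ) {x : M} {σ : Alt E a} {U : MVec E p}
    (hU : ∀ hσ : σ ∈ D.S a x, D.sharp a p x ⟨σ, hσ⟩ = Submodule.Quotient.mk U)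
    (hσ : castDeg h σ ∈ D.S b x) :
    D.sharp b p x ⟨castDeg h σ, hσ⟩ = Submodule.Quotient.mk U := by
  subst h
  exact hU hσ

variable (D F τ) in
/-- `ι_ε U` represents the class `♯(dα ∧ ε)` up to a nonzero constant factor, for all closed basic
forms `ε` of the complementary degree. -/
def WedgeRep {a p m : ℕ} (ha : a + 1 + p = m + 1) (α : Form E M a) (U : MVField E M (p + 1)) :
    Prop :=
  ∀ e : Form E M p, IsClosedBasic F τ e → ∃ C : ℝ, C ≠ 0 ∧
    ∀ (x : M) (σ : Alt E (m + 1)) (hσ : σ ∈ D.S (m + 1) x), σ = wd ha (d α x) (e x) →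
      D.sharp (m + 1) 1 x ⟨σ, hσ⟩ = Submodule.Quotient.mk (C • contractForm rfl (e x) (U x))

theorem IsSpecial.wd_mem (hτ : ContMDiff 𝓘(ℝ, E) 𝓘(ℝ, F) ∞ τ) {a p m : ℕ} {α : Form E M a}
    (hα : D.IsSpecial F τ a α) (hap : a + p = m) (ha : a + 1 + p = m + 1) (hm : m + 1 = n)
    {e : Form E M p} (he : IsClosedBasic F τ e) (x : M) :
    wd ha (d α x) (e x) ∈ D.S (m + 1) x := by
  have h1 := (hα.isHamiltonian_wdF hap hm he).2.2 x
  rwa [d_wdF hap ha hα.1.2.1 (he.1.smoothForm hτ) he.2] at h1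

/-- Passes from global closed basic forms to arbitrary semi-basic forms at `x`, where the algebra
takes place. -/
theorem WedgeRep.contractionRep [T2Space X] (hτ : IsFiberedManifold E F τ) {a p m : ℕ}
    {α : Form E M a} (hα : D.IsSpecial F τ a α) {ha : a + 1 + p = m + 1} (hm : m + 1 = n)
    {U : MVField E M (p + 1)} (hU : D.WedgeRep F τ ha α U) (x : M) :
    D.ContractionRep F τ ha x (d α x) (U x) := by
  intro ε hε
  obtain ⟨e, he, rfl⟩ := exists_isClosedBasic hτ x hε
  obtain ⟨C, hC, h⟩ := hU e he
  exact ⟨C, hC, hα.wd_mem hτ.smooth (by omega) ha hm he x, h x _ _ rfl⟩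

/-- Up to a nonzero constant, `{α ∧ e₁, β ∧ e₂} = {α, β} ∧ e₂ ∧ e₁`. -/
theorem exists_bracket_wdF [T2Space X] (hn : Module.finrank ℝ F = n)
    (hτ : IsFiberedManifold E F τ) (hD : D.IsFibered F τ) (hv : D.SharpVertical F τ)
    {a b c p q m : ℕ} (hk : b + (q + 1) = n) (hc : q + 1 + c = a + 1) (hm : m + 1 = n)
    {ha : a + 1 + p = m + 1} {hb : b + 1 + q = m + 1} (hap : a + p = m) (hbq : b + q = m)
    (hcq : c + q = a) {α : Form E M a} {β : Form E M b} (hα : D.IsSpecial F τ a α)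
    (hβ : D.IsSpecial F τ b β) {U : MVField E M (p + 1)} {V : MVField E M (q + 1)}
    (hαU : D.WedgeRep F τ ha α U) (hβV : D.WedgeRep F τ hb β V)
    (hV : ∀ x, D.sharp (b + 1) (q + 1) x ⟨d β x, hβ.1.2.2 x⟩ = Submodule.Quotient.mk (V x))
    {e₁ : Form E M p} {e₂ : Form E M q} (he₁ : IsClosedBasic F τ e₁)
    (he₂ : IsClosedBasic F τ e₂) (h1m : 1 + m = m + 1) :
    ∃ K : ℝ, K ≠ 0 ∧ D.bracket hm h1m (wdF hap α e₁) (wdF hbq β e₂)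
        (hβ.wdF hτ.smooth hbq hm he₂).1
      = K • wdF hap (wdF hcq (D.bracket hk hc α β hβ.1) e₂) e₁ := by
  have ha1 := hα.1.1
  obtain ⟨κ, hκ, key⟩ := exists_wd_interior E F n q c (by omega)
  obtain ⟨C, hC, h⟩ := hβV e₂ he₂
  -- `C` comes from `♯(dβ ∧ e₂)`, `κ⁻¹` from the algebraic comparison, and the sign undoes the one
  -- in `{α, β}`; the bracket of `(n-1)`-forms carries no sign. All three are chosen before the
  -- point `x`.
  refine ⟨C * κ⁻¹ * (-1 : ℝ) ^ (n - 1 - b),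
    mul_ne_zero (mul_ne_zero hC (inv_ne_zero hκ)) (pow_ne_zero _ (by norm_num)), ?_⟩
  funext x
  obtain ⟨Φ⟩ := exists_horizontalFrame hn (hτ.submersion x)
  have hA := hαU.contractionRep hτ hα hm x
  have hB := hβV.contractionRep hτ hβ hm x
  have hAv : VertDegreeLeOne (dmap E F τ x) (d α x) :=
    (hD.horizontal (a + 1) (by omega) ha1 x _ (hα.1.2.2 x)).vertDegreeLeOne
  have key' := key (dmap E F τ x) Φ (a + 1) a hc (add_comm 1 a) hcq (V x) (d α x)
    (fun σ hσ => hB.apply_semibasic hv hm Φ hσ) hAv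
    (fun l hl ε hε hlε => hA.covecWedge_interior_eq_zero hv hm hB hAv Φ hl hε hlε _)
  have h1 : ∀ {s t : ℕ} {ζ : Form E M s} (hζ : D.IsSpecial F τ s ζ) (hst : s + t = m)
      (h' : s + 1 + t = m + 1) {e : Form E M t} (_ : IsClosedBasic F τ e),
      d (wdF hst ζ e) x = wd h' (d ζ x) (e x) := fun {s t ζ} hζ hst h' {e} he =>
    congrFun (d_wdF hst h' hζ.1.2.1 (he.1.smoothForm hτ.smooth) he.2) x
  rw [D.bracket_eq hm h1m _ _ (hα.wdF hτ.smooth hap hm he₁).1 (hβ.wdF hτ.smooth hbq hm he₂).1 x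
    (C • contractForm rfl (e₂ x) (V x)) (h x _ _ (h1 hβ hbq hb he₂)), h1 hα hap ha he₁,
    smul_interior, hB.interior_wd hv hm hc hcq hap h1m hκ (add_comm 1 a) key'
      (he₁.1.isSemibasic x) (he₂.1.isSemibasic x), Pi.smul_apply, wdF, wdF,
    D.bracket_eq hk hc α β hα.1 hβ.1 x (V x) (hV x), smul_wd, smul_wd]
  simp only [smul_smul]
  congr 1
  rw [show n - 1 - m = 0 by omega, pow_zero, one_mul, mul_assoc _ ((-1 : ℝ) ^ _), ← mul_pow,
    neg_one_mul, neg_neg, one_pow, mul_one]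

/-- For special Hamiltonian forms `α` and `β`, the form `d{α, β} ∧ ε` lies in the Dirac structure
for every semi-basic `ε` of the complementary degree. -/
theorem IsSpecial.bracket_wd_mem [T2Space X] (hn : Module.finrank ℝ F = n)
    (hτ : IsFiberedManifold E F τ) (hD : D.IsFibered F τ) (hv : D.SharpVertical F τ)
    {a b c p q m e : ℕ} (hk : b + (q + 1) = n) (hc : q + 1 + c = a + 1) (hm : m + 1 = n)
    (ha : a + 1 + p = m + 1) (hb : b + 1 + q = m + 1) {α : Form E M a} {β : Form E M b}
    (hα : D.IsSpecial F τ a α) (hβ : D.IsSpecial F τ b β) {U : MVField E M (p + 1)}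
    {V : MVField E M (q + 1)} (hαU : D.WedgeRep F τ ha α U) (hβV : D.WedgeRep F τ hb β V)
    (hV : ∀ x, D.sharp (b + 1) (q + 1) x ⟨d β x, hβ.1.2.2 x⟩ = Submodule.Quotient.mk (V x))
    (hγ : D.IsHamiltonian c (D.bracket hk hc α β hβ.1)) (h1m : 1 + m = m + 1)
    (hbr : ∀ ζ η : Form E M m, D.IsSpecial F τ m ζ → ∀ hη : D.IsSpecial F τ m η,
      D.IsHamiltonian m (D.bracket hm h1m ζ η hη.1))
    (he : c + 1 + e = m + 1) (x : M) {ε : Alt E e} (hε : IsSemibasic (dmap E F τ x) ε) :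
    wd he (d (D.bracket hk hc α β hβ.1) x) ε ∈ D.S (m + 1) x := by
  obtain ⟨Φ⟩ := exists_horizontalFrame hn (hτ.submersion x)
  have h1 : c + 1 + q = a + 1 := by omega
  have hcq : c + q = a := by omega
  have hap : a + p = m := by omega
  refine Φ.wd_mem_of_wd_wd_mem h1 ha he (D.S (m + 1) x) (fun ε₁ hε₁ ε₂ hε₂ => ?_) hε
  obtain ⟨e₁, he₁, rfl⟩ := exists_isClosedBasic hτ x hε₁
  obtain ⟨e₂, he₂, rfl⟩ := exists_isClosedBasic hτ x hε₂
  obtain ⟨K, hK, h⟩ := exists_bracket_wdF hn hτ hD hv hk hc hm hap (by omega) hcq hα hβ hαU hβV hV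
    he₁ he₂ h1m
  have h2 := (hbr _ _ (hα.wdF hτ.smooth hap hm he₁) (hβ.wdF hτ.smooth (by omega) hm he₂)).2.2 x
  have s₁ := IsBasic.smoothForm hτ.smooth he₁.1
  have s₂ := IsBasic.smoothForm hτ.smooth he₂.1
  -- As `e₁` and `e₂` are closed, the differential falls on the bracket alone.
  rw [h, d_smul, d_wdF hap ha (SmoothForm.wdF hcq hγ.2.1 s₂) s₁ he₁.2, d_wdF hcq h1 hγ.2.1 s₂ he₂.2]
    at h2
  have h3 := (D.S (m + 1) x).smul_mem K⁻¹ h2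
  rwa [Pi.smul_apply, inv_smul_smul₀ hK] at h3

end GradedDirac

end GDirac

end

/-! ### The subalgebra theorem. -/

theorem mainTheorem6
    {E : Type*} [NormedAddCommGroup E] [NormedSpace ℝ E] [FiniteDimensional ℝ E]
    {F : Type*} [NormedAddCommGroup F] [NormedSpace ℝ F] [FiniteDimensional ℝ F]
    {M : Type*} [TopologicalSpace M] [T2Space M] [SecondCountableTopology M]
    [ChartedSpace E M] [IsManifold 𝓘(ℝ, E) ∞ M]
    {X : Type*} [TopologicalSpace X] [T2Space X] [SecondCountableTopology X]
    [ChartedSpace F X] [IsManifold 𝓘(ℝ, F) ∞ X]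
    (n : ℕ) (hn : Module.finrank ℝ F = n)
    (τ : M → X) (hτ : IsFiberedManifold E F τ)
    (D : GradedDirac E M n) (hD : D.IsFibered F τ)
    (hvert : 2 ≤ n → D.SharpVertical F τ)
    (hU : ∀ (a k : ℕ) (_ : a + k = n) (α : Form E M a) (hα : D.IsSpecial F τ a α),
      ∃ U : MVField E M k, SmoothMV U ∧
        (∀ x, D.sharp (a + 1) k x ⟨d α x, hα.1.2.2 x⟩ = Submodule.Quotient.mk (U x)) ∧
        ∀ (b p : ℕ) (hb : b + p = k), 1 ≤ p → ∀ ε : Form E M b, IsClosedBasic F τ ε →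
          ∃ C : ℝ, C ≠ 0 ∧ ∀ (x : M) (h : wedge (d α x) (ε x) ∈ D.S (a + 1 + b) x),
            D.sharp (a + 1 + b) p x ⟨wedge (d α x) (ε x), h⟩
              = Submodule.Quotient.mk (C • contractForm hb (ε x) (U x))) :
    (∀ a : ℕ, a + 1 ≤ n →
      ∃ N : Submodule ℝ (Form E M a), ∀ α, α ∈ N ↔ D.IsSpecial F τ a α) ∧
    (∀ (a b c k : ℕ) (hk : b + k = n) (hc : k + c = a + 1) (α : Form E M a) (β : Form E M b)
      (_ : D.IsSpecial F τ a α) (hβ : D.IsSpecial F τ b β),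
      D.IsSpecial F τ c (D.bracket hk hc α β hβ.1)) := by

  have hbr : ∀ (a b c k p : ℕ) (hk : b + k = n) (hc : k + c = a + 1) (_ : a + p = n)
      (α : Form E M a) (β : Form E M b) (_ : D.IsSpecial F τ a α) (hβ : D.IsSpecial F τ b β),
      D.IsHamiltonian c (D.bracket hk hc α β hβ.1) := by
    intro a b c k p hk hc hp α β hα hβ
    obtain ⟨U, hUs, hU1, -⟩ := hU a p hp α hα
    obtain ⟨V, hVs, hV1, -⟩ := hU b k hk β hβ
    exact hα.1.bracket hk hc hp hβ.1 hUs hVs hU1 hV1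
  have hrep : ∀ (a p m : ℕ) (ha : a + 1 + p = m + 1) (_ : m + 1 = n) (α : Form E M a)
      (hα : D.IsSpecial F τ a α), ∃ U : MVField E M (p + 1),
        (∀ x, D.sharp (a + 1) (p + 1) x ⟨d α x, hα.1.2.2 x⟩ = Submodule.Quotient.mk (U x)) ∧
        D.WedgeRep F τ ha α U := by
    intro a p m ha hm α hα
    obtain ⟨U, -, h1, h2⟩ := hU a (p + 1) (by omega) α hα
    refine ⟨U, h1, fun e he => ?_⟩
    -- Only the complementary degree is needed, where contracting `U` leaves a `1`-vector.
    obtain ⟨C, hC, h⟩ := h2 p 1 rfl le_rfl e he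
    refine ⟨C, hC, fun x σ hσ h3 => ?_⟩
    subst h3
    exact GradedDirac.sharp_castDeg ha 1 (h x) hσ
  refine ⟨fun a ha => ⟨D.specialForms F τ a ha, fun α => Iff.rfl⟩, ?_⟩
  intro a b c k hk hc α β hα hβ
  have ha1 := hα.1.1
  have hb1 := hβ.1.1
  have hγ := hbr a b c k (n - a) hk hc (by omega) α β hα hβ
  refine ⟨hγ, fun e he ε hε => ⟨he.le, ?_, fun x => ?_⟩⟩
  · exact SmoothForm.wdF rfl hγ.2.1 (hε.1.smoothForm hτ.smooth)
  have hce : c + 1 + e = c + e + 1 := by omega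
  have h1 : d (wedgeF (D.bracket hk hc α β hβ.1) ε) x
      = wd hce (d (D.bracket hk hc α β hβ.1) x) (ε x) :=
    congrFun (d_wdF rfl hce hγ.2.1 (hε.1.smoothForm hτ.smooth) hε.2) x
  rw [h1]
  by_cases h2 : 2 ≤ n
  · obtain ⟨q, rfl⟩ : ∃ q, k = q + 1 := ⟨k - 1, by omega⟩
    obtain ⟨p, hp⟩ : ∃ p, a + 1 + p = c + e + 1 := ⟨n - (a + 1), by omega⟩
    have hq : b + 1 + q = c + e + 1 := by omega
    obtain ⟨U, -, hαU⟩ := hrep a p (c + e) hp he α hα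
    obtain ⟨V, hV, hβV⟩ := hrep b q (c + e) hq he β hβ
    exact hα.bracket_wd_mem hn hτ hD (hvert h2) hk hc he hp hq hβ hαU hβV hV hγ (by omega)
      (fun ζ η hζ hη => hbr _ _ _ _ 1 he _ he ζ η hζ hη) hce x (hε.1.isSemibasic x)
  -- Here `n = 1`: there is no verticality assumption, but `ε` is a function and wedging with it is
  -- scalar multiplication at each point.
  · obtain rfl : e = 0 := by omega
    have h3 : wd hce (d (D.bracket hk hc α β hβ.1) x) (ε x)
        = ε x Fin.elim0 • d (D.bracket hk hc α β hβ.1) x := wd_degree_zero _ _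
    rw [h3]
    exact (D.S (c + 1) x).smul_mem _ (hγ.2.2 x)
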